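/- Let $H$ be an invertible Hermitian $n\times n$ matrix and let $B\in\mathbb C^{n\times n}$ be $H$-nonnegative, i.e. $[Bx,x]=(HBx,x)\ge 0$ for all $x\in\mathbb C^n$. Write $J_k(\lambda)$ for the $k\times k$ Jordan block with eigenvalue $\lambda$. A Segre pairing of $B$ is a multiset $\mathcal S$ of pairs $(a,b)$ of integers with $a\ge 1$, $a\ge b\ge 0$ and $a-b\le 1$ such that the nonzero members of the pairs in $\mathcal S$ are, with multiplicities, exactly the sizes of the Jordan blocks of $B$ at the eigenvalue $0$. A square root associated with the pair $(a,b)$ is a matrix $X$ with $X^2=J_a(0)\oplus J_b(0)$ (where $J_0(0)$ is empty), the zero matrix being excluded for the pair $(1,1)$. A square root $A$ of $B$ (that is, $A^2=B$) is said to be associated with $\mathcal S$ if there is an invertible $P$ such that $$P^{-1}BP=B'\oplus\bigoplus_{(a,b)\in\mathcal S}\bigl(J_a(0)\oplus J_b(0)\bigr),\qquad P^{-1}AP=A'\oplus\bigoplus_{(a,b)\in\mathcal S}X_{(a,b)},$$ with $B'$ invertible, $A'^2=B'$ and each $X_{(a,b)}$ a square root associated with the corresponding pair. Then all eigenvalues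 of $B$ are real; let $\lambda_1,\dots,\lambda_q>0$ and $\lambda_{q+1},\dots,\lambda_r<0$ be its nonzero eigenvalues, counted with multiplicities. The following hold. 1. Every square root $A$ of $B$ is associated with one and only one Segre pairing $\mathcal S$ of $B$. 2. If $A$ is a square root of $B$ associated with the Segre pairing $\mathcal S$, and $\ell_1,\ell_2,\ell_3,\ell_4$ are the numbers of pairs $(1,0),(1,1),(2,1),(2,2)$ in $\mathcal S$, respectively, then there are signs $\delta_1,\dots,\delta_r\in\{1,-1\}$ such that $A$ has the Jordan form $A_-\oplus A_0\oplus A_+$ with $$A_+=\bigoplus_{j=1}^{q}J_1(\delta_j\sqrt{\lambda_j}),\qquad A_-=\bigoplus_{j=1}^{r-q}J_1(i\,\delta_{q+j}\sqrt{-\lambda_{q+j}}),$$ $$A_0=\bigoplus_{i=1}^{\ell_1}J_1(0)\oplus\bigoplus_{i=1}^{\ell_2}J_2(0)\oplus\bigoplus_{i=1}^{\ell_3}J_3(0)\oplus\bigoplus_{i=1}^{\ell_4}J_4(0).$$ 3. Conversely, for every Segre pairing $\mathcal S$ of $B$ and all signs $\delta_1,\dots,\delta_r\in\{1,-1\}$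 there is a square root of $B$ associated with $\mathcal S$ that has this Jordan form. -/

import Mathlib

open scoped ComplexOrder

namespace HRoot

noncomputable section

/-- The indefinite inner product `[x, y] = (H x, y)`, where `(u, v) = ∑ i, u i * conj (v i)`. -/
def indefInner {n : ℕ} (H : Matrix (Fin n) (Fin n) ℂ) (x y : Fin n → ℂ) : ℂ :=
  (H.mulVec x) ⬝ᵥ star y

/-- `B` is `H`-nonnegative: `[B x, x]` is real and nonnegative for every `x`. (The relation `0 ≤ z`
for complex `z` means that `z` is a nonnegative real number.) -/
def IsHNonnegative {n : ℕ} (H B : Matrix (Fin n) (Fin n) ℂ) : Prop :=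
  ∀ x : Fin n → ℂ, 0 ≤ indefInner H (B.mulVec x) x

/-- The matrices `S` and `T` are inverse to each other (`T = S⁻¹`). Row and column index types may
differ in name, so that a matrix on `Fin n` can be compared with a block matrix. -/
def MutuallyInverse {m n : Type*} [Fintype m] [DecidableEq m] [Fintype n] [DecidableEq n]
    (S : Matrix m n ℂ) (T : Matrix n m ℂ) : Prop :=
  S * T = 1 ∧ T * S = 1

/-- `A` is similar to `J`: `S⁻¹ A S = J` for some invertible `S`. -/
def Similar {m n : Type*} [Fintype m] [DecidableEq m] [Fintype n] [DecidableEq n]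
    (A : Matrix m m ℂ) (J : Matrix n n ℂ) : Prop :=
  ∃ (S : Matrix m n ℂ) (T : Matrix n m ℂ), MutuallyInverse S T ∧ T * A * S = J

/-- The Jordan block `J_k(c)`, with `c` on the diagonal and ones on the superdiagonal. -/
def jordanBlock (k : ℕ) (c : ℂ) : Matrix (Fin k) (Fin k) ℂ :=
  Matrix.of fun i j => if i = j then c else if (i : ℕ) + 1 = (j : ℕ) then 1 else 0

/-- The direct sum of the Jordan blocks `J_{k i}(c i)`. -/
def jordanSum {ι : Type*} [DecidableEq ι] (k : ι → ℕ) (c : ι → ℂ) :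
    Matrix (Σ i, Fin (k i)) (Σ i, Fin (k i)) ℂ :=
  Matrix.blockDiagonal' fun i => jordanBlock (k i) (c i)

/-- The direct sum `A ⊕ B` of two square matrices. -/
def dsum {m n : Type*} (A : Matrix m m ℂ) (B : Matrix n n ℂ) : Matrix (m ⊕ n) (m ⊕ n) ℂ :=
  Matrix.fromBlocks A 0 0 B

/-- `s` is the Segre characteristic of `B` at `c`: the multiset of the sizes of the blocks with
eigenvalue `c` in a Jordan form of `B`. -/
def IsSegreCharacteristic {n : ℕ} (B : Matrix (Fin n) (Fin n) ℂ) (c : ℂ) (s : Multiset ℕ) : Prop :=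
  ∃ (r : ℕ) (k : Fin r → ℕ) (ev : Fin r → ℂ), (∀ i, 0 < k i) ∧ Similar B (jordanSum k ev) ∧
    s = ((Finset.univ.filter fun i => ev i = c).val.map k)

/-- `S` is a Segre pairing of the multiset `s` of positive numbers: every entry of `s` is used in
one and only one pair (the nonzero members of the pairs form `s`, with multiplicities); every pair
is made of two entries of `s` or of one entry and a zero, the larger one first; and the members of
a pair differ by at most one. A lexicographically arranged collection of pairs is the same as a
multiset of pairs. -/
def IsSegrePairing (s : Multiset ℕ) (S : Multiset (ℕ × ℕ)) : Prop :=
  S.map Prod.fst + (S.map Prod.snd).filter (fun a => a ≠ 0) = s ∧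
    ∀ p ∈ S, p.1 ≠ 0 ∧ p.2 ≤ p.1 ∧ p.1 ≤ p.2 + 1

/-- `S` is a Segre pairing of `B`, that is, of the Segre characteristic of `B` at zero. -/
def IsSegrePairingOf {n : ℕ} (B : Matrix (Fin n) (Fin n) ℂ) (S : Multiset (ℕ × ℕ)) : Prop :=
  ∃ s : Multiset ℕ, IsSegreCharacteristic B 0 s ∧ IsSegrePairing s S

/-- The nilpotent matrix `J_a(0) ⊕ J_b(0)` of a pair `(a, b)` (only `J_a(0)` if `b = 0`). -/
def pairBlock (p : ℕ × ℕ) : Matrix (Fin p.1 ⊕ Fin p.2) (Fin p.1 ⊕ Fin p.2) ℂ :=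
  dsum (jordanBlock p.1 0) (jordanBlock p.2 0)

/-- `X` is a square root associated with the pair `p`: a square root of `J_a(0) ⊕ J_b(0)`, where by
agreement the zero matrix is not allowed for the pair `(1, 1)`. -/
def IsPairRoot (p : ℕ × ℕ) (X : Matrix (Fin p.1 ⊕ Fin p.2) (Fin p.1 ⊕ Fin p.2) ℂ) : Prop :=
  X * X = pairBlock p ∧ (p = (1, 1) → X ≠ 0)

/-- The square root `A` of `B` is associated with `S`: in some basis `B` is the direct sum of an
invertible matrix `B'` and the blocks `J_a(0) ⊕ J_b(0)`, `(a, b) ∈ S`, and in the same basis `A`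
is the direct sum of a square root of `B'` and of square roots associated with the pairs in `S`. -/
def IsAssociatedWith {n : ℕ} (A B : Matrix (Fin n) (Fin n) ℂ) (S : Multiset (ℕ × ℕ)) : Prop :=
  ∃ (d N : ℕ) (A' B' : Matrix (Fin d) (Fin d) ℂ) (p : Fin N → ℕ × ℕ)
    (X : ∀ i, Matrix (Fin (p i).1 ⊕ Fin (p i).2) (Fin (p i).1 ⊕ Fin (p i).2) ℂ)
    (P : Matrix (Fin n) (Fin d ⊕ Σ i, (Fin (p i).1 ⊕ Fin (p i).2)) ℂ)
    (Q : Matrix (Fin d ⊕ Σ i, (Fin (p i).1 ⊕ Fin (p i).2)) (Fin n) ℂ),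
    MutuallyInverse P Q ∧ Finset.univ.val.map p = S ∧
    IsUnit B' ∧ A' * A' = B' ∧ (∀ i, IsPairRoot (p i) (X i)) ∧
    Q * B * P = dsum B' (Matrix.blockDiagonal' fun i => pairBlock (p i)) ∧
    Q * A * P = dsum A' (Matrix.blockDiagonal' X)

/-- `A₊ = ⊕ J₁(δ_j √λ_j)`. -/
def rootPos {q : ℕ} (lam : Fin q → ℝ) (δ : Fin q → ℤˣ) :
    Matrix (Σ _ : Fin q, Fin 1) (Σ _ : Fin q, Fin 1) ℂ :=
  jordanSum (fun _ => 1) fun j => ((δ j : ℤ) : ℂ) * (Real.sqrt (lam j) : ℂ)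

/-- `A₋ = ⊕ J₁(i δ_j √(-λ_j))`. -/
def rootNeg {m : ℕ} (lam : Fin m → ℝ) (δ : Fin m → ℤˣ) :
    Matrix (Σ _ : Fin m, Fin 1) (Σ _ : Fin m, Fin 1) ℂ :=
  jordanSum (fun _ => 1) fun j => Complex.I * ((δ j : ℤ) : ℂ) * (Real.sqrt (-lam j) : ℂ)

/-- The direct sum of `l` copies of `J_k(0)`. -/
def nilCopies (l k : ℕ) : Matrix (Σ _ : Fin l, Fin k) (Σ _ : Fin l, Fin k) ℂ :=
  jordanSum (fun _ => k) fun _ => 0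

/-- `A₀`: one block `J₁(0)`, `J₂(0)`, `J₃(0)`, `J₄(0)` for each pair `(1,0)`, `(1,1)`, `(2,1)`,
`(2,2)` in `S`, respectively. -/
def rootZero (S : Multiset (ℕ × ℕ)) :=
  dsum (nilCopies (S.count (1, 0)) 1) (dsum (nilCopies (S.count (1, 1)) 2)
    (dsum (nilCopies (S.count (2, 1)) 3) (nilCopies (S.count (2, 2)) 4)))

/-- `A` has the Jordan form `A₋ ⊕ A₀ ⊕ A₊`. -/
def HasRootJordanForm {n q m : ℕ} (A : Matrix (Fin n) (Fin n) ℂ) (pos : Fin q → ℝ)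
    (neg : Fin m → ℝ) (S : Multiset (ℕ × ℕ)) (δ : Fin q → ℤˣ) (δ' : Fin m → ℤˣ) : Prop :=
  Similar A (dsum (rootNeg neg δ') (dsum (rootZero S) (rootPos pos δ)))

/-- The numbers `pos j > 0` and `neg j < 0` are the nonzero eigenvalues of `B`, counted with their
(algebraic) multiplicities. -/
def EnumeratesNonzeroEigenvalues {n q m : ℕ} (B : Matrix (Fin n) (Fin n) ℂ) (pos : Fin q → ℝ)
    (neg : Fin m → ℝ) : Prop :=
  (∀ j, 0 < pos j) ∧ (∀ j, neg j < 0) ∧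
    B.charpoly.roots.filter (fun z => z ≠ 0) =
      Finset.univ.val.map (fun j => (pos j : ℂ)) + Finset.univ.val.map (fun j => (neg j : ℂ))

end

end HRoot

namespace HRoot

open Matrix Polynomial

set_option linter.unusedSectionVars false

/-! ### Similarity of matrices over different index types -/

section Similarity

variable {m n o p : Type*} [Fintype m] [DecidableEq m] [Fintype n] [DecidableEq n]
  [Fintype o] [DecidableEq o] [Fintype p] [DecidableEq p]

/-! The form `H` enters only through one polynomial. Since `H * B` is positive semidefinite, it
equals `Rᴴ * R`, so `B = L * R` with `L = H⁻¹ * Rᴴ`, while `C = R * L` is Hermitian and `B * L = L *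
C`. If `g` is the product of `X - c` over the distinct nonzero (real) eigenvalues of `C`, then `X *
g` kills `C`, and the extra factor of `B = L * R` gives that `X ^ 2 * g` kills `B`
(`exists_annihilator`). So the nonzero eigenvalues of `B` are real and semisimple, and its blocks at
zero have size at most 2. Everything else follows from this annihilator.

A square root `A` is killed by `X ^ 4 * g(X ^ 2)`, whose nonzero roots are simple. Hence `A` is
similar to an invertible diagonal matrix plus nilpotent blocks of size at most 4
(`root_sizes_of_annihilator`). Taking every other vector of a chain of length `s` shows that the
square of `J_s(0)` is `J_a(0) ⊕ J_b(0)` with `a = ⌈s/2⌉`, `b = ⌊s/2⌋` (`chainRoot_mul_self`), so the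
nilpotent blocks of `A` yield a Segre pairing.

Conversely, for the four possible pairs every admissible root of `J_a(0) ⊕ J_b(0)` is one chain of
length `a + b` (`IsPairRoot.similar`). An associated pairing therefore determines the nilpotent
block sizes `a + b` of `A`. Those sizes are similarity invariants (`nilpotent_sizes_unique`), and a
balanced pair is recovered from its sum, so the pairing is unique and the nilpotent part of the
Jordan form is known. On the invertible part the eigenvalues of `A` square to those of `B`, which
leaves exactly a choice of signs.

For existence, a model with the prescribed signs and chains is written down. Its square has the same
Jordan blocks as `B`, so a change of basis carries the model to a root of `B`. -/

theorem Similar.refl (A : Matrix m m ℂ) : Similar A A :=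
  ⟨1, 1, ⟨by simp, by simp⟩, by simp⟩

theorem Similar.symm {A : Matrix m m ℂ} {J : Matrix n n ℂ} (h : Similar A J) : Similar J A := by
  obtain ⟨S, T, ⟨h1, h2⟩, rfl⟩ := h
  refine ⟨T, S, ⟨h2, h1⟩, ?_⟩
  calc S * (T * A * S) * T = (S * T) * A * (S * T) := by simp only [Matrix.mul_assoc]
    _ = A := by rw [h1]; simp

theorem Similar.trans {A : Matrix m m ℂ} {B : Matrix n n ℂ} {C : Matrix o o ℂ}
    (h : Similar A B) (h' : Similar B C) : Similar A C := by
  obtain ⟨S, T, ⟨h1, h2⟩, rfl⟩ := h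
  obtain ⟨S', T', ⟨h1', h2'⟩, rfl⟩ := h'
  refine ⟨S * S', T' * T, ⟨?_, ?_⟩, by simp only [Matrix.mul_assoc]⟩
  · calc S * S' * (T' * T) = S * (S' * T') * T := by simp only [Matrix.mul_assoc]
      _ = 1 := by rw [h1']; simpa using h1
  · calc T' * T * (S * S') = T' * (T * S) * S' := by simp only [Matrix.mul_assoc]
      _ = 1 := by rw [h2]; simpa using h2'

/-- Matrices that agree up to a bijection of the indices are similar. -/
theorem Similar.of_equiv {A : Matrix m m ℂ} {J : Matrix n n ℂ} (e : n ≃ m)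
    (h : ∀ i j, A (e i) (e j) = J i j) : Similar A J := by
  refine ⟨(1 : Matrix m m ℂ).submatrix id e, (1 : Matrix m m ℂ).submatrix e id, ⟨?_, ?_⟩, ?_⟩
  · rw [Matrix.submatrix_mul_equiv]; simp
  · rw [← Matrix.submatrix_mul _ _ e id e Function.bijective_id]; simp
  · ext i j
    rw [← h i j, ← Matrix.submatrix_id_id A, ← Matrix.submatrix_mul _ _ _ _ _ Function.bijective_id,
      ← Matrix.submatrix_mul _ _ _ _ _ Function.bijective_id]
    simp

theorem MutuallyInverse.conj_mul {A A₂ : Matrix m m ℂ} {S : Matrix m n ℂ} {T : Matrix n m ℂ}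
    (h : MutuallyInverse S T) : T * (A * A₂) * S = (T * A * S) * (T * A₂ * S) := by
  calc T * (A * A₂) * S = T * A * (1 : Matrix m m ℂ) * A₂ * S := by
        simp only [Matrix.mul_assoc, Matrix.one_mul]
    _ = _ := by rw [← h.1]; simp only [Matrix.mul_assoc]

theorem Similar.mul_self {A : Matrix m m ℂ} {J : Matrix n n ℂ} (h : Similar A J) :
    Similar (A * A) (J * J) := by
  obtain ⟨S, T, h1, rfl⟩ := h
  exact ⟨S, T, h1, MutuallyInverse.conj_mul h1⟩

/-- Conjugation by mutually inverse matrices as an isomorphism of algebras. -/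
def conjAlgEquiv {S : Matrix m n ℂ} {T : Matrix n m ℂ} (h : MutuallyInverse S T) :
    Matrix m m ℂ →ₐ[ℂ] Matrix n n ℂ :=
  AlgHom.ofLinearMap
    { toFun := fun A => T * A * S
      map_add' := fun A B => by rw [Matrix.mul_add, Matrix.add_mul]
      map_smul' := fun c A => by simp }
    (by simpa using h.2) (fun A B => MutuallyInverse.conj_mul h)

theorem Similar.pow {A : Matrix m m ℂ} {J : Matrix n n ℂ} (h : Similar A J) (k : ℕ) :
    Similar (A ^ k) (J ^ k) := by
  obtain ⟨S, T, h1, rfl⟩ := h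
  exact ⟨S, T, h1, map_pow (conjAlgEquiv h1) A k⟩

theorem Similar.aeval {A : Matrix m m ℂ} {J : Matrix n n ℂ} (h : Similar A J) (f : ℂ[X]) :
    Similar (aeval A f) (aeval J f) := by
  obtain ⟨S, T, h1, rfl⟩ := h
  exact ⟨S, T, h1, (Polynomial.aeval_algHom_apply (conjAlgEquiv h1) A f).symm⟩

theorem Similar.eq_zero {J : Matrix n n ℂ} (h : Similar (0 : Matrix m m ℂ) J) : J = 0 := by
  obtain ⟨S, T, -, rfl⟩ := h
  simp

theorem Similar.isUnit {A : Matrix m m ℂ} {J : Matrix n n ℂ} (h : Similar A J) (hA : IsUnit A) :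
    IsUnit J := by
  obtain ⟨S, T, h1, rfl⟩ := h
  exact hA.map (conjAlgEquiv h1)

theorem Similar.rank_eq {A : Matrix m m ℂ} {J : Matrix n n ℂ} (h : Similar A J) :
    A.rank = J.rank := by
  refine le_antisymm ?_ ?_
  · obtain ⟨S, T, -, rfl⟩ := h.symm
    exact (Matrix.rank_mul_le_left _ _).trans (Matrix.rank_mul_le_right _ _)
  · obtain ⟨S, T, -, rfl⟩ := h
    exact (Matrix.rank_mul_le_left _ _).trans (Matrix.rank_mul_le_right _ _)

theorem Similar.charpoly_eq {A : Matrix m m ℂ} {J : Matrix n n ℂ} (h : Similar A J) :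
    A.charpoly = J.charpoly := by
  obtain ⟨S, T, ⟨h1, h2⟩, rfl⟩ := h
  -- The transition matrices are rectangular a priori; comparing ranks with the identity forces them
  -- to be square, so commuting the factors costs no power of `X`.
  have hc : Fintype.card n = Fintype.card m := by
    refine le_antisymm ?_ ?_
    · have := (Matrix.rank_mul_le_left T S).trans (Matrix.rank_le_card_width T)
      rwa [h2, Matrix.rank_one] at this
    · have := (Matrix.rank_mul_le_left S T).trans (Matrix.rank_le_card_width S)
      rwa [h1, Matrix.rank_one] at this
  rw [Matrix.mul_assoc, Matrix.charpoly_mul_comm_of_le _ _ hc.ge, hc, Matrix.mul_assoc, h1]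
  simp

theorem MutuallyInverse.dsum {S : Matrix m n ℂ} {T : Matrix n m ℂ} {S' : Matrix o p ℂ}
    {T' : Matrix p o ℂ} (h : MutuallyInverse S T) (h' : MutuallyInverse S' T') :
    MutuallyInverse (fromBlocks S 0 0 S') (fromBlocks T 0 0 T') := by
  constructor <;> simp [Matrix.fromBlocks_multiply, h.1, h.2, h'.1, h'.2]

theorem Similar.dsum {A : Matrix m m ℂ} {J : Matrix n n ℂ} {A' : Matrix o o ℂ}
    {J' : Matrix p p ℂ} (h : Similar A J) (h' : Similar A' J') :
    Similar (dsum A A') (dsum J J') := by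
  obtain ⟨S, T, h1, rfl⟩ := h
  obtain ⟨S', T', h1', rfl⟩ := h'
  exact ⟨_, _, h1.dsum h1', by simp [HRoot.dsum, Matrix.fromBlocks_multiply]⟩

theorem dsum_mul (A A' : Matrix m m ℂ) (B B' : Matrix n n ℂ) :
    dsum A B * dsum A' B' = dsum (A * A') (B * B') := by
  simp [dsum, Matrix.fromBlocks_multiply]

theorem dsum_pow (A : Matrix m m ℂ) (B : Matrix n n ℂ) (k : ℕ) :
    dsum A B ^ k = dsum (A ^ k) (B ^ k) := by
  induction k with
  | zero => simp [dsum]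
  | succ k ih => rw [pow_succ, ih, dsum_mul, pow_succ, pow_succ]

theorem blockDiagonal'_similar {ι : Type*} [Fintype ι] [DecidableEq ι] {m n : ι → Type*}
    [∀ i, Fintype (m i)] [∀ i, DecidableEq (m i)] [∀ i, Fintype (n i)] [∀ i, DecidableEq (n i)]
    {A : ∀ i, Matrix (m i) (m i) ℂ} {J : ∀ i, Matrix (n i) (n i) ℂ}
    (h : ∀ i, Similar (A i) (J i)) : Similar (blockDiagonal' A) (blockDiagonal' J) := by
  choose S T h1 h2 using h
  refine ⟨blockDiagonal' S, blockDiagonal' T, ⟨?_, ?_⟩, ?_⟩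
  · rw [← Matrix.blockDiagonal'_mul, ← Matrix.blockDiagonal'_one]
    exact congrArg _ (funext fun i => (h1 i).1)
  · rw [← Matrix.blockDiagonal'_mul, ← Matrix.blockDiagonal'_one]
    exact congrArg _ (funext fun i => (h1 i).2)
  · rw [← Matrix.blockDiagonal'_mul, ← Matrix.blockDiagonal'_mul]
    exact congrArg _ (funext h2)

end Similarity

/-! ### Rearranging direct sums of Jordan blocks -/

section JordanSums

variable {ι κ : Type*} [Fintype ι] [DecidableEq ι] [Fintype κ] [DecidableEq κ]

theorem jordanSum_apply (k : ι → ℕ) (c : ι → ℂ) (x y : Σ i, Fin (k i)) :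
    jordanSum k c x y = if x.1 = y.1 then
      (if (x.2 : ℕ) = y.2 then c x.1 else if (x.2 : ℕ) + 1 = y.2 then 1 else 0) else 0 := by
  obtain ⟨i, a⟩ := x
  obtain ⟨j, b⟩ := y
  rw [jordanSum, Matrix.blockDiagonal'_apply]
  by_cases h : i = j
  · subst h
    simp [jordanBlock, Fin.ext_iff]
  · simp [h]

theorem jordanSum_reindex (e : κ ≃ ι) {k : ι → ℕ} {c : ι → ℂ} {k' : κ → ℕ} {c' : κ → ℂ}
    (hk : ∀ i, k (e i) = k' i) (hc : ∀ i, c (e i) = c' i) :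
    Similar (jordanSum k c) (jordanSum k' c') := by
  refine Similar.of_equiv
    { toFun := fun x => ⟨e x.1, Fin.cast (hk _).symm x.2⟩
      invFun := fun x => ⟨e.symm x.1, Fin.cast (by rw [← hk, e.apply_symm_apply]) x.2⟩
      left_inv := fun x => by
        refine Sigma.ext (e.symm_apply_apply _) ?_
        exact (Fin.heq_ext_iff (by simp)).2 rfl
      right_inv := fun x => by
        refine Sigma.ext (e.apply_symm_apply _) ?_
        exact (Fin.heq_ext_iff (by simp)).2 rfl } ?_
  rintro ⟨i, a⟩ ⟨j, b⟩
  simp [jordanSum_apply, hc]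

theorem jordanSum_sum (k : ι → ℕ) (c : ι → ℂ) (k' : κ → ℕ) (c' : κ → ℂ) :
    Similar (dsum (jordanSum k c) (jordanSum k' c'))
      (jordanSum (Sum.elim k k') (Sum.elim c c')) := by
  refine (Similar.of_equiv
    { toFun := fun x => Sum.rec (motive := fun _ => Σ i, Fin (Sum.elim k k' i))
        (fun y => ⟨.inl y.1, y.2⟩) (fun y => ⟨.inr y.1, y.2⟩) x
      invFun := fun x => match x with
        | ⟨.inl i, a⟩ => .inl ⟨i, a⟩
        | ⟨.inr i, a⟩ => .inr ⟨i, a⟩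
      left_inv := by rintro (x | x) <;> rfl
      right_inv := by rintro ⟨i | i, a⟩ <;> rfl } ?_).symm
  rintro (⟨i, a⟩ | ⟨i, a⟩) (⟨j, b⟩ | ⟨j, b⟩) <;>
    simp [jordanSum_apply, dsum]

/-- Blocks of size zero may be dropped. -/
theorem jordanSum_drop_zero (k : ι → ℕ) (c : ι → ℂ) :
    Similar (jordanSum k c)
      (jordanSum (fun i : {i // k i ≠ 0} => k i) (fun i : {i // k i ≠ 0} => c i)) := by
  refine Similar.of_equiv
    { toFun := fun x => ⟨x.1, x.2⟩
      invFun := fun x => ⟨⟨x.1, fun h => by have := x.2.2; omega⟩, x.2⟩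
      left_inv := fun x => rfl
      right_inv := fun x => rfl } ?_
  rintro ⟨i, a⟩ ⟨j, b⟩
  simp [jordanSum_apply, Subtype.ext_iff]

/-- Equal multiplicities mean equipotent fibres, and bijections of the fibres glue. This turns
multiset identities, for block lists as well as for eigenvalues, into matchings of indices. -/
theorem exists_equiv_of_map_univ_eq {α : Type*} {f : ι → α} {g : κ → α}
    (h : Finset.univ.val.map f = Finset.univ.val.map g) : ∃ e : κ ≃ ι, ∀ i, f (e i) = g i := by
  classical
  have hc : ∀ a, Nonempty ({j // g j = a} ≃ {i // f i = a}) := fun a => by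
    rw [← Fintype.card_eq, Fintype.card_subtype, Fintype.card_subtype]
    simpa [Multiset.count_map, Finset.card, Finset.filter_val, eq_comm] using
      (congrArg (Multiset.count a) h).symm
  exact ⟨Equiv.ofFiberEquiv fun a => (hc a).some, fun i => Equiv.ofFiberEquiv_map _ i⟩

/-- The multiset of the (size, eigenvalue) pairs of the nonempty blocks of a Jordan sum. -/
def jordanData (k : ι → ℕ) (c : ι → ℂ) : Multiset (ℕ × ℂ) :=
  (Finset.univ.val.map fun i => (k i, c i)).filter fun x => x.1 ≠ 0

theorem jordanData_eq (k : ι → ℕ) (c : ι → ℂ) :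
    jordanData k c = Finset.univ.val.map fun i : {i // k i ≠ 0} => (k i, c i) := by
  rw [jordanData, Multiset.filter_map]
  have : (Finset.univ : Finset {i // k i ≠ 0}).val.map Subtype.val =
      Finset.univ.val.filter fun i => k i ≠ 0 := by
    have := congrArg Finset.val (Finset.subtype_map (p := fun i => k i ≠ 0) (s := Finset.univ))
    simpa using this
  rw [show (fun i : {i // k i ≠ 0} => (k i, c i)) = (fun i => (k i, c i)) ∘ Subtype.val from rfl,
    ← Multiset.map_map, this]
  rfl

/-- Empty blocks carry no indices, so a matching of the nonempty ones suffices. Later similarities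
between Jordan sums reduce in this way to arithmetic with multisets. -/
theorem similar_of_jordanData_eq {k : ι → ℕ} {c : ι → ℂ} {k' : κ → ℕ} {c' : κ → ℂ}
    (h : jordanData k c = jordanData k' c') : Similar (jordanSum k c) (jordanSum k' c') := by
  rw [jordanData_eq, jordanData_eq] at h
  obtain ⟨e, he⟩ := exists_equiv_of_map_univ_eq h
  refine (jordanSum_drop_zero k c).trans (Similar.trans ?_ (jordanSum_drop_zero k' c').symm)
  exact jordanSum_reindex e (fun i => congrArg Prod.fst (he i)) fun i => congrArg Prod.snd (he i)

theorem map_univ_sum {α : Type*} (f : ι ⊕ κ → α) :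
    (Finset.univ : Finset (ι ⊕ κ)).val.map f =
      Finset.univ.val.map (fun i => f (.inl i)) + Finset.univ.val.map fun i => f (.inr i) := by
  rw [← Finset.univ_disjSum_univ]
  simp [Finset.disjSum, Multiset.disjSum, Multiset.map_map]

theorem jordanData_sum (k : ι → ℕ) (c : ι → ℂ) (k' : κ → ℕ) (c' : κ → ℂ) :
    jordanData (Sum.elim k k') (Sum.elim c c') = jordanData k c + jordanData k' c' := by
  simp [jordanData, map_univ_sum]

theorem exists_fin_map_eq {α : Type*} (s : Multiset α) :
    ∃ (r : ℕ) (f : Fin r → α), Finset.univ.val.map f = s := by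
  induction s using Quotient.inductionOn with
  | h l => exact ⟨l.length, l.get, by simp [Fin.univ_def]⟩

theorem diagonal_similar (ν : ι → ℂ) : Similar (diagonal ν) (jordanSum (fun _ : ι => 1) ν) := by
  refine Similar.of_equiv (Equiv.sigmaUnique ι fun _ => Fin 1) ?_
  rintro ⟨i, a⟩ ⟨j, b⟩
  rw [Subsingleton.elim a 0, Subsingleton.elim b 0]
  simp [jordanSum_apply, diagonal_apply]

end JordanSums

/-! ### Existence of the Jordan form -/

section JordanForm

/-- Apply `g ^ i` to a relation: terms with `j < i` reach the power `N` and vanish, and terms with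
`j > i` have zero coefficient by induction, so only `w i • (g ^ (N - 1)) v` survives. The chain is
listed from the highest power down so that `g` lowers the index, matching ones on the superdiagonal.
-/
theorem linearIndependent_of_cyclic {V : Type*} [AddCommGroup V] [Module ℂ V] {N : ℕ}
    {g : Module.End ℂ V} {v : V} (h0 : (g ^ N) v = 0) (h1 : 0 < N → (g ^ (N - 1)) v ≠ 0) :
    LinearIndependent ℂ fun i : Fin N => (g ^ (N - 1 - i)) v := by
  rw [Fintype.linearIndependent_iff]
  intro w hw
  have key : ∀ n : ℕ, ∀ i : Fin N, N - 1 - (i : ℕ) = n → w i = 0 := by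
    intro n
    induction n using Nat.strong_induction_on with
    | _ n ih =>
      intro i hi
      have h := congrArg (g ^ (i : ℕ)) hw
      rw [map_sum, map_zero, Finset.sum_eq_single i] at h
      · rw [map_smul, ← Module.End.mul_apply, ← pow_add,
          show (i : ℕ) + (N - 1 - i) = N - 1 by omega] at h
        exact (smul_eq_zero.1 h).resolve_right (h1 (by omega))
      · intro j _ hj
        rw [map_smul, ← Module.End.mul_apply, ← pow_add]
        have hj' : (j : ℕ) ≠ i := fun h => hj (Fin.ext h)
        rcases lt_or_gt_of_ne hj' with hlt | hgt
        · rw [show (i : ℕ) + (N - 1 - j) = (i - 1 - j) + N by omega, pow_add,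
            Module.End.mul_apply, h0, map_zero, smul_zero]
        · rw [ih (N - 1 - j) (by omega) j rfl, zero_smul]
      · simp
  exact fun i => key _ i rfl

/-- A nilpotent endomorphism with a cyclic vector acts on some basis by one Jordan chain. -/
theorem exists_basis_of_cyclic {V : Type*} [AddCommGroup V] [Module ℂ V] [FiniteDimensional ℂ V]
    {N : ℕ} (hN : Module.finrank ℂ V = N) {g : Module.End ℂ V} {v : V} (h0 : (g ^ N) v = 0)
    (h1 : 0 < N → (g ^ (N - 1)) v ≠ 0) :
    ∃ b : Module.Basis (Fin N) ℂ V, ∀ j : Fin N,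
      g (b j) = if 0 < (j : ℕ) then b ⟨j - 1, by omega⟩ else 0 := by
  rcases Nat.eq_zero_or_pos N with rfl | hpos
  · exact ⟨(Module.finBasis ℂ V).reindex (finCongr hN), fun j => j.elim0⟩
  · have : Nonempty (Fin N) := ⟨⟨0, hpos⟩⟩
    refine ⟨basisOfLinearIndependentOfCardEqFinrank (linearIndependent_of_cyclic h0 h1)
      (by simp [hN]), fun j => ?_⟩
    simp only [coe_basisOfLinearIndependentOfCardEqFinrank]
    rw [← Module.End.mul_apply, ← pow_succ']
    split_ifs with hj
    · rw [show N - 1 - (j : ℕ) + 1 = N - 1 - (j - 1) by omega]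
    · rw [show N - 1 - (j : ℕ) + 1 = N by omega, h0]

/-- Multiplication by `X - c` on this quotient is nilpotent with cyclic vector `1`. The prime `q` is
given only up to a unit, as the structure theorem supplies it. -/
theorem exists_basis_quotient_pow (c : ℂ) (e : ℕ) {q : ℂ[X]} (hq : Associated q (X - C c)) :
    ∃ b : Module.Basis (Fin e) ℂ (ℂ[X] ⧸ Submodule.span ℂ[X] {q ^ e}), ∀ j : Fin e,
      (X : ℂ[X]) • b j = c • b j + if 0 < (j : ℕ) then b ⟨j - 1, by omega⟩ else 0 := by
  have hspan : Submodule.span ℂ[X] {q ^ e} = Ideal.span {(X - C c) ^ e} :=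
    Ideal.span_singleton_eq_span_singleton.2 hq.pow_pow
  rw [hspan]
  set I : Ideal ℂ[X] := Ideal.span {(X - C c) ^ e} with hI
  have hdim : Module.finrank ℂ (ℂ[X] ⧸ I) = e := by
    rw [hI, finrank_quotient_span_eq_natDegree]
    simp
  have : FiniteDimensional ℂ (ℂ[X] ⧸ I) := by
    rcases Nat.eq_zero_or_pos e with rfl | hpos
    · have : Subsingleton (ℂ[X] ⧸ I) := by
        rw [Ideal.Quotient.subsingleton_iff, hI]; simp
      infer_instance
    · exact Module.finite_of_finrank_pos (by omega)
  let g : Module.End ℂ (ℂ[X] ⧸ I) := LinearMap.mulLeft ℂ (Ideal.Quotient.mk I (X - C c))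
  have hg : ∀ n, (g ^ n) 1 = Ideal.Quotient.mk I ((X - C c) ^ n) := fun n => by
    rw [LinearMap.pow_mulLeft]
    simp
  obtain ⟨b, hb⟩ := exists_basis_of_cyclic hdim (g := g) (v := 1)
    (by rw [hg, Ideal.Quotient.eq_zero_iff_mem, hI]; exact Ideal.mem_span_singleton_self _)
    (fun he => by
      rw [hg, Ne, Ideal.Quotient.eq_zero_iff_mem, hI, Ideal.mem_span_singleton,
        pow_dvd_pow_iff (X_sub_C_ne_zero c) (not_isUnit_X_sub_C c)]
      omega)
  refine ⟨b, fun j => ?_⟩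
  rw [← hb]
  have hX : (X : ℂ[X]) • b j = Ideal.Quotient.mk I X * b j := by
    rw [← Ideal.Quotient.algebraMap_eq, ← Algebra.smul_def]
  have hC : c • b j = Ideal.Quotient.mk I (C c) * b j := by
    rw [← Ideal.Quotient.algebraMap_eq, ← Algebra.smul_def, ← Polynomial.algebraMap_eq,
      algebraMap_smul]
  rw [hX, hC]
  simp [g, sub_mul]

/-- Let `X` act on `V` as `φ`. The structure theorem for torsion modules over the principal ideal
domain `ℂ[X]` splits `V` into cyclic primary summands, whose primes are linear over `ℂ`; each
summand gives one block. -/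
theorem exists_jordan_basis {V : Type} [AddCommGroup V] [Module ℂ V] [FiniteDimensional ℂ V]
    (φ : Module.End ℂ V) :
    ∃ (ι : Type) (_ : Fintype ι) (k : ι → ℕ) (c : ι → ℂ)
      (b : Module.Basis (Σ i, Fin (k i)) ℂ V), ∀ (i : ι) (j : Fin (k i)),
      φ (b ⟨i, j⟩) = c i • b ⟨i, j⟩ + if 0 < (j : ℕ) then b ⟨i, ⟨j - 1, by omega⟩⟩ else 0 := by
  classical
  obtain ⟨ι, hι, q, hq, e, ⟨E⟩⟩ := Module.equiv_directSum_of_isTorsion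
    (R := ℂ[X]) (M := Module.AEval' φ) (Module.AEval.isTorsion_of_finiteDimensional ℂ V φ)
  have hc : ∀ i, ∃ c, Associated (q i) (X - C c) := fun i => by
    obtain ⟨c, hc⟩ := IsAlgClosed.exists_root (q i)
      (by rw [(IsAlgClosed.degree_eq_one_of_irreducible ℂ (hq i))]; exact one_ne_zero)
    exact ⟨c, ((irreducible_X_sub_C c).associated_of_dvd (hq i) (dvd_iff_isRoot.2 hc)).symm⟩
  choose c hc using hc
  choose b hb using fun i => exists_basis_quotient_pow (c i) (e i) (hc i)
  let β := ((DFinsupp.basis b).map (E.restrictScalars ℂ).symm).map (Module.AEval'.of φ).symm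
  have hβ : ∀ x, E (Module.AEval'.of φ (β x)) = DFinsupp.basis b x := fun x => by
    simp [β]
  have hD : ∀ i (j : Fin (e i)), DFinsupp.basis b ⟨i, j⟩ = DFinsupp.single i (b i j) := by
    intro i j
    apply (DFinsupp.basis b).repr.injective
    rw [Module.Basis.repr_self]
    ext ⟨i', j'⟩
    by_cases h : i = i'
    · subst h
      simp [DFinsupp.basis, Finsupp.single_apply]
    · simp [DFinsupp.basis, h]
  refine ⟨ι, hι, e, c, β, fun i j => ?_⟩
  apply (Module.AEval'.of φ).injective
  apply E.injective
  have hX : (X : ℂ[X]) • (DFinsupp.single i (b i j) :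
      DirectSum ι fun i => ℂ[X] ⧸ Submodule.span ℂ[X] {q i ^ e i}) =
      DFinsupp.single i ((X : ℂ[X]) • b i j) := (DFinsupp.single_smul _ _).symm
  have hC : ∀ x, E (c i • x) = c i • E x := fun x => (E.restrictScalars ℂ).map_smul (c i) x
  rw [← Module.AEval'.X_smul_of, map_smul, hβ, map_add, map_add, map_smul, hC, hβ, hD, hX, hb,
    DFinsupp.single_add, DFinsupp.single_smul]
  split_ifs
  · rw [hβ, hD]
  · simp

/-- Every complex square matrix has a Jordan form. -/
theorem exists_similar_jordanSum {n : ℕ} (A : Matrix (Fin n) (Fin n) ℂ) :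
    ∃ (r : ℕ) (k : Fin r → ℕ) (c : Fin r → ℂ), Similar A (jordanSum k c) := by
  obtain ⟨ι, hι, k, c, b, hb⟩ := exists_jordan_basis (Matrix.toLin' A)
  classical
  suffices h : Similar A (jordanSum k c) from
    ⟨_, _, _, h.trans (jordanSum_reindex (Fintype.equivFin ι).symm (fun _ => rfl) fun _ => rfl)⟩
  refine ⟨(Pi.basisFun ℂ (Fin n)).toMatrix b, b.toMatrix (Pi.basisFun ℂ (Fin n)),
    ⟨Module.Basis.toMatrix_mul_toMatrix_flip _ _, Module.Basis.toMatrix_mul_toMatrix_flip _ _⟩, ?_⟩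
  have hA : LinearMap.toMatrix (Pi.basisFun ℂ (Fin n)) (Pi.basisFun ℂ (Fin n)) (Matrix.toLin' A) =
      A := by
    rw [LinearMap.toMatrix_eq_toMatrix', LinearMap.toMatrix'_toLin']
  conv_lhs => rw [← hA]
  rw [basis_toMatrix_mul_linearMap_toMatrix_mul_basis_toMatrix]
  ext ⟨i, a⟩ ⟨j, a'⟩
  rw [LinearMap.toMatrix_apply, hb, jordanSum_apply]
  by_cases hij : i = j
  · subst hij
    split_ifs <;> simp_all [Finsupp.single_apply, Fin.ext_iff] <;> omega
  · have : j ≠ i := fun h => hij h.symm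
    split_ifs <;> simp_all

end JordanForm

/-! ### Annihilating polynomials bound block sizes -/

section Blocks

theorem jordanBlock_zero_pow_apply (k j : ℕ) (x y : Fin k) :
    (jordanBlock k 0 ^ j) x y = if (x : ℕ) + j = y then 1 else 0 := by
  induction j generalizing y with
  | zero => simp [Matrix.one_apply, Fin.ext_iff]
  | succ j ih =>
    rw [pow_succ, Matrix.mul_apply]
    simp only [ih]
    have hJ : ∀ z, jordanBlock k 0 z y = if (z : ℕ) + 1 = y then 1 else 0 := fun z => by
      simp only [jordanBlock, Matrix.of_apply]
      split_ifs <;> simp_all [Fin.ext_iff]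
    simp only [hJ, ite_mul, one_mul, zero_mul]
    by_cases h : (x : ℕ) + (j + 1) = y
    · rw [Finset.sum_eq_single ⟨x + j, by omega⟩]
      · simp [h]; omega
      · intro z _ hz
        rw [if_neg]
        intro h'
        exact hz (Fin.ext h'.symm)
      · simp
    · rw [if_neg h]
      refine Finset.sum_eq_zero fun z _ => ?_
      split_ifs <;> first | rfl | omega

theorem jordanBlock_zero_pow_eq_zero {k j : ℕ} (h : k ≤ j) : jordanBlock k 0 ^ j = 0 := by
  ext x y
  rw [jordanBlock_zero_pow_apply, if_neg (by omega)]
  rfl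

theorem jordanBlock_sub (k : ℕ) (c : ℂ) :
    jordanBlock k c - algebraMap ℂ _ c = jordanBlock k 0 := by
  ext x y
  simp only [jordanBlock, Matrix.sub_apply, Matrix.of_apply, Matrix.algebraMap_matrix_apply]
  split_ifs <;> simp

/-- The size of a Jordan block is bounded by the multiplicity of its eigenvalue as a root of an
annihilating polynomial. -/
theorem jordanBlock_size_le {k a : ℕ} {c : ℂ} {g : ℂ[X]} (hg : g.eval c ≠ 0)
    (h : aeval (jordanBlock k c) ((X - C c) ^ a * g) = 0) : k ≤ a := by
  have hN : aeval (jordanBlock k c) (X - C c) = jordanBlock k 0 := by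
    rw [map_sub, aeval_X, aeval_C, jordanBlock_sub]
  -- The Bézout identity, evaluated at the block, makes `g` of the block invertible. Hence the
  -- `a`-th power of the nilpotent part is zero, which its entry `(0, a)` contradicts if `a < k`.
  have hco : IsCoprime ((X - C c) ^ k) g := by
    refine IsCoprime.pow_left ((Irreducible.coprime_iff_not_dvd (irreducible_X_sub_C c)).2 ?_)
    rwa [dvd_iff_isRoot]
  obtain ⟨u, v, huv⟩ := hco
  have h1 := congrArg (aeval (jordanBlock k c)) huv
  rw [map_add, map_mul, map_mul, map_pow, hN, jordanBlock_zero_pow_eq_zero le_rfl, mul_zero,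
    zero_add, map_one, ← map_mul, mul_comm, map_mul] at h1
  have h2 : jordanBlock k 0 ^ a = 0 := by
    rw [map_mul, map_pow, hN] at h
    rw [← mul_one (jordanBlock k 0 ^ a), ← h1, ← mul_assoc, h, zero_mul]
  by_contra! hlt
  have h3 := congrFun (congrFun h2 ⟨0, by omega⟩) ⟨a, hlt⟩
  simp [jordanBlock_zero_pow_apply] at h3

/-- Block diagonal matrices as the image of an algebra homomorphism. -/
def blockDiagonal'AlgHom {ι : Type*} [Fintype ι] [DecidableEq ι] (k : ι → ℕ) :
    (∀ i, Matrix (Fin (k i)) (Fin (k i)) ℂ) →ₐ[ℂ]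
      Matrix (Σ i, Fin (k i)) (Σ i, Fin (k i)) ℂ :=
  { Matrix.blockDiagonal'RingHom (fun i => Fin (k i)) ℂ with
    commutes' := fun c => by
      simp [Matrix.algebraMap_eq_diagonal, Pi.algebraMap_def, Matrix.blockDiagonal'_diagonal] }

theorem aeval_jordanBlock_eq_zero {ι : Type*} [Fintype ι] [DecidableEq ι] {k : ι → ℕ}
    {c : ι → ℂ} {f : ℂ[X]} (h : aeval (jordanSum k c) f = 0) (i : ι) :
    aeval (jordanBlock (k i) (c i)) f = 0 := by
  have h1 : jordanSum k c = blockDiagonal'AlgHom k fun i => jordanBlock (k i) (c i) := rfl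
  rw [h1, Polynomial.aeval_algHom_apply] at h
  have h2 : aeval (fun i => jordanBlock (k i) (c i)) f = 0 :=
    Matrix.blockDiagonal'_injective (h.trans (map_zero (blockDiagonal'AlgHom k)).symm)
  have h3 := Polynomial.aeval_algHom_apply
    (Pi.evalAlgHom ℂ (fun i => Matrix (Fin (k i)) (Fin (k i)) ℂ) i)
    (fun i => jordanBlock (k i) (c i)) f
  rw [h2, map_zero] at h3
  exact h3

end Blocks

/-! ### Nilpotent parts and ranks of powers -/

section Nilpotent

variable {m n : Type*} [Fintype m] [DecidableEq m] [Fintype n] [DecidableEq n]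

theorem charpoly_of_isNilpotent {N : Matrix m m ℂ} (h : IsNilpotent N) :
    N.charpoly = X ^ Fintype.card m :=
  sub_eq_zero.1 (Matrix.isNilpotent_charpoly_sub_pow_of_isNilpotent h).eq_zero

theorem pow_card_eq_zero {N : Matrix m m ℂ} (h : IsNilpotent N) : N ^ Fintype.card m = 0 := by
  have := Matrix.aeval_self_charpoly N
  rwa [charpoly_of_isNilpotent h, map_pow, aeval_X] at this

/-- A vector not killed by `N ^ (k - 1)` is cyclic, since its chain already has the length of the
whole space. -/
theorem similar_jordanBlock_of_cyclic {N : Matrix m m ℂ} (h0 : IsNilpotent N) {k : ℕ}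
    (hk : Fintype.card m = k) (h1 : 0 < k → N ^ (k - 1) ≠ 0) : Similar N (jordanBlock k 0) := by
  have hex : ∃ v, 0 < k → (Matrix.toLin' N ^ (k - 1)) v ≠ 0 := by
    by_contra! hc
    rcases Nat.eq_zero_or_pos k with rfl | hpos
    · exact absurd (hc 0).1 (by simp)
    · refine h1 hpos ((Matrix.toLin').injective (LinearMap.ext fun v => ?_))
      rw [Matrix.toLin'_pow, (hc v).2]
      simp
  obtain ⟨v, hv⟩ := hex
  obtain ⟨b, hb⟩ := exists_basis_of_cyclic (V := m → ℂ) (N := k) (by simp [hk])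
    (g := Matrix.toLin' N) (v := v)
    (by rw [← Matrix.toLin'_pow, ← hk, pow_card_eq_zero h0]; simp) hv
  refine ⟨(Pi.basisFun ℂ m).toMatrix b, b.toMatrix (Pi.basisFun ℂ m),
    ⟨Module.Basis.toMatrix_mul_toMatrix_flip _ _, Module.Basis.toMatrix_mul_toMatrix_flip _ _⟩, ?_⟩
  have hA : LinearMap.toMatrix (Pi.basisFun ℂ m) (Pi.basisFun ℂ m) (Matrix.toLin' N) = N := by
    rw [LinearMap.toMatrix_eq_toMatrix', LinearMap.toMatrix'_toLin']
  conv_lhs => rw [← hA]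
  rw [basis_toMatrix_mul_linearMap_toMatrix_mul_basis_toMatrix]
  ext a a'
  rw [LinearMap.toMatrix_apply, hb]
  simp only [jordanBlock, Matrix.of_apply]
  split_ifs <;> simp_all [Finsupp.single_apply, Fin.ext_iff] <;> omega

theorem jordanSum_zero_pow_apply {ι : Type*} [Fintype ι] [DecidableEq ι] (κ : ι → ℕ) (j : ℕ)
    (x y : Σ i, Fin (κ i)) : (jordanSum κ (fun _ => 0) ^ j) x y =
      if x.1 = y.1 ∧ (x.2 : ℕ) + j = y.2 then 1 else 0 := by
  obtain ⟨i, a⟩ := x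
  obtain ⟨i', a'⟩ := y
  rw [jordanSum, ← Matrix.blockDiagonal'_pow, Matrix.blockDiagonal'_apply]
  by_cases h : i = i'
  · subst h
    simp [jordanBlock_zero_pow_apply]
  · simp [h]

theorem isNilpotent_jordanSum {ι : Type*} [Fintype ι] [DecidableEq ι] (κ : ι → ℕ) :
    IsNilpotent (jordanSum κ fun _ => 0) := by
  refine ⟨∑ i, κ i, ?_⟩
  ext x y
  rw [jordanSum_zero_pow_apply, if_neg]
  · rfl
  · have := Finset.single_le_sum (f := κ) (fun _ _ => Nat.zero_le _) (Finset.mem_univ y.1)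
    omega

/-- Factoring through `u` bounds the rank above; compressing to the identity of `u` bounds it below.
-/
theorem rank_eq_card_of_factor {u : Type*} [Fintype u] [DecidableEq u] {M : Matrix m m ℂ}
    {L : Matrix m u ℂ} {R : Matrix u m ℂ} {L' : Matrix u m ℂ} {R' : Matrix m u ℂ}
    (h : L * R = M) (h' : L' * M * R' = 1) : M.rank = Fintype.card u := by
  refine le_antisymm ?_ ?_
  · rw [← h]
    exact (Matrix.rank_mul_le_left _ _).trans (Matrix.rank_le_card_width _)
  · have := (Matrix.rank_mul_le_left (L' * M) R').trans (Matrix.rank_mul_le_right L' M)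
    rwa [h', Matrix.rank_one] at this

theorem rank_dsum_jordanSum_pow {ι : Type*} [Fintype ι] [DecidableEq ι] {D : Matrix m m ℂ}
    (hD : IsUnit D) (κ : ι → ℕ) (j : ℕ) :
    (dsum D (jordanSum κ fun _ => 0) ^ j).rank = Fintype.card m + ∑ i, (κ i - j) := by
  -- The `j`-th power of a block has ones exactly on the `j`-th superdiagonal; `lo` and `hi` give
  -- the row and the column of each. Truncated subtraction accounts for blocks that the power kills.
  let lo : (Σ i, Fin (κ i - j)) → Σ i, Fin (κ i) := fun u => ⟨u.1, ⟨u.2, by omega⟩⟩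
  let hi : (Σ i, Fin (κ i - j)) → Σ i, Fin (κ i) := fun u => ⟨u.1, ⟨u.2 + j, by omega⟩⟩
  obtain ⟨E, hE⟩ := (hD.pow j).exists_left_inv
  set J := jordanSum κ (fun _ => 0) ^ j with hJ
  have h1 : (1 : Matrix (Σ i, Fin (κ i)) _ ℂ).submatrix id lo *
      (1 : Matrix (Σ i, Fin (κ i)) _ ℂ).submatrix hi id = J := by
    ext x y
    rw [hJ, jordanSum_zero_pow_apply, Matrix.mul_apply]
    obtain ⟨i, a⟩ := x
    obtain ⟨i', a'⟩ := y
    simp only [Matrix.submatrix_apply, Matrix.one_apply, id, mul_ite, mul_one, mul_zero]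
    by_cases h : i = i' ∧ (a : ℕ) + j = a'
    · obtain ⟨rfl, h⟩ := h
      rw [Finset.sum_eq_single ⟨i, ⟨a, by omega⟩⟩]
      · simp [lo, hi, h]
      · rintro ⟨l, z⟩ _ hz
        rw [← ite_and, if_neg]
        rintro ⟨-, h'⟩
        apply hz
        simp only [lo, Sigma.mk.injEq] at h'
        obtain ⟨rfl, h'⟩ := h'
        simp only [heq_eq_eq, Fin.ext_iff] at h'
        simp [h']
      · simp
    · rw [if_neg h]
      refine Finset.sum_eq_zero ?_
      rintro ⟨l, z⟩ _
      rw [← ite_and, if_neg]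
      rintro ⟨h', h''⟩
      apply h
      simp only [lo, hi, Sigma.mk.injEq] at h' h''
      obtain ⟨rfl, h'⟩ := h'
      obtain ⟨rfl, h''⟩ := h''
      simp only [heq_eq_eq, Fin.ext_iff] at h' h''
      exact ⟨rfl, by omega⟩
  let L' : Matrix (Σ i, Fin (κ i - j)) (Σ i, Fin (κ i)) ℂ :=
    (1 : Matrix (Σ i, Fin (κ i)) (Σ i, Fin (κ i)) ℂ).submatrix lo id
  let R' : Matrix (Σ i, Fin (κ i)) (Σ i, Fin (κ i - j)) ℂ :=
    (1 : Matrix (Σ i, Fin (κ i)) (Σ i, Fin (κ i)) ℂ).submatrix id hi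
  have h2 : L' * J * R' = 1 := by
    have : L' * J * R' = J.submatrix lo hi := by
      rw [← Matrix.submatrix_id_id J, ← Matrix.submatrix_mul _ _ _ _ _ Function.bijective_id,
        ← Matrix.submatrix_mul _ _ _ _ _ Function.bijective_id]
      simp
    rw [this]
    ext ⟨i, a⟩ ⟨i', a'⟩
    rw [Matrix.submatrix_apply, hJ, jordanSum_zero_pow_apply, Matrix.one_apply]
    by_cases h : i = i'
    · subst h
      simp [lo, hi, Fin.ext_iff]
    · simp [lo, hi, h]
  rw [dsum_pow, rank_eq_card_of_factor (L := fromBlocks (D ^ j) 0 0 _) (R := fromBlocks 1 0 0 _)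
    (L' := fromBlocks E 0 0 L') (R' := fromBlocks 1 0 0 R')
    (by rw [Matrix.fromBlocks_multiply]; simp only [Matrix.mul_one, Matrix.mul_zero,
          Matrix.zero_mul, add_zero, zero_add]; rw [h1]; rfl)
    (by rw [dsum, Matrix.fromBlocks_multiply, Matrix.fromBlocks_multiply]
        simp only [Matrix.mul_one, Matrix.mul_zero, Matrix.zero_mul, add_zero, zero_add]
        rw [h2, hE, Matrix.fromBlocks_one])]
  simp

/-- The second difference in `j` of the truncated `x - j` is the indicator of `x = j + 1`, so
multiplicities of sizes can be read off from ranks. -/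
theorem sum_truncated_sub (s : Multiset ℕ) (j : ℕ) :
    (s.map fun x => x - j).sum + (s.map fun x => x - (j + 2)).sum =
      2 * (s.map fun x => x - (j + 1)).sum + s.count (j + 1) := by
  induction s using Multiset.induction_on with
  | empty => simp
  | cons a s ih =>
    simp only [Multiset.map_cons, Multiset.sum_cons, Multiset.count_cons]
    split_ifs <;> omega

/-- The sizes of the nilpotent Jordan blocks are determined up to similarity. -/
theorem nilpotent_sizes_unique {ι ι' : Type*} [Fintype ι] [DecidableEq ι] [Fintype ι']
    [DecidableEq ι'] {D : Matrix m m ℂ} {D' : Matrix n n ℂ} (hD : IsUnit D) (hD' : IsUnit D')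
    {κ : ι → ℕ} {κ' : ι' → ℕ} (h0 : ∀ i, κ i ≠ 0) (h0' : ∀ i, κ' i ≠ 0)
    (h : Similar (dsum D (jordanSum κ fun _ => 0)) (dsum D' (jordanSum κ' fun _ => 0))) :
    Finset.univ.val.map κ = Finset.univ.val.map κ' := by
  have hr : ∀ j, Fintype.card m + ∑ i, (κ i - j) = Fintype.card n + ∑ i, (κ' i - j) := fun j => by
    rw [← rank_dsum_jordanSum_pow hD, ← rank_dsum_jordanSum_pow hD', (h.pow j).rank_eq]
  have hc : Fintype.card m = Fintype.card n := by
    -- A power this high kills both nilpotent parts, leaving only the ranks of the invertible parts.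
    have h1 := hr (∑ i, κ i + ∑ i, κ' i)
    rw [Finset.sum_eq_zero, Finset.sum_eq_zero] at h1
    · exact h1
    · intro i hi
      have := Finset.single_le_sum (f := κ') (fun _ _ => Nat.zero_le _) hi
      omega
    · intro i hi
      have := Finset.single_le_sum (f := κ) (fun _ _ => Nat.zero_le _) hi
      omega
  have hs : ∀ j, ((Finset.univ.val.map κ).map fun x => x - j).sum =
      ((Finset.univ.val.map κ').map fun x => x - j).sum := fun j => by
    rw [Multiset.map_map, Multiset.map_map]
    have := hr j
    rw [hc] at this
    exact Nat.add_left_cancel this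
  ext a
  rcases a with _ | a
  · rw [Multiset.count_eq_zero_of_notMem, Multiset.count_eq_zero_of_notMem] <;> simp [h0, h0']
  · have h1 := sum_truncated_sub (Finset.univ.val.map κ) a
    have h2 := sum_truncated_sub (Finset.univ.val.map κ') a
    rw [hs, hs, hs] at h1
    omega

end Nilpotent

/-! ### The annihilating polynomial of an `H`-nonnegative matrix -/

section Annihilator

variable {n : ℕ}

/-- Over `ℂ` a matrix whose quadratic form takes real values is Hermitian, so nonnegativity of the
form alone suffices. -/
theorem posSemidef_of_isHNonnegative {H B : Matrix (Fin n) (Fin n) ℂ} (hB : IsHNonnegative H B) :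
    (H * B).PosSemidef := by
  rw [← Matrix.isPositive_toEuclideanLin_iff, LinearMap.isPositive_iff_complex]
  intro x
  have h := hB x.ofLp
  have hx : inner ℂ (Matrix.toEuclideanLin (H * B) x) x =
      star (indefInner H (B.mulVec x.ofLp) x.ofLp) := by
    rw [EuclideanSpace.inner_eq_star_dotProduct, indefInner, Matrix.mulVec_mulVec,
      ← Matrix.star_dotProduct_star, star_star]
    rfl
  obtain ⟨h1, h2⟩ := Complex.le_def.1 h
  rw [hx]
  simp only [Complex.zero_re, Complex.zero_im] at h1 h2
  refine ⟨Complex.ext ?_ ?_, ?_⟩ <;> simp [h1, ← h2]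

theorem aeval_diagonal {m : Type*} [Fintype m] [DecidableEq m] (d : m → ℂ) (f : ℂ[X]) :
    aeval (diagonal d) f = diagonal fun i => f.eval (d i) := by
  have h : diagonal d = Matrix.diagonalAlgHom ℂ d := rfl
  rw [h, Polynomial.aeval_algHom_apply]
  change diagonal (aeval d f) = _
  congr 1
  ext i
  simp

theorem aeval_isHermitian_eq_zero {C : Matrix (Fin n) (Fin n) ℂ} (hC : C.IsHermitian) {f : ℂ[X]}
    (hf : ∀ i, f.eval (hC.eigenvalues i : ℂ) = 0) : aeval C f = 0 := by
  rw [hC.spectral_theorem, Polynomial.aeval_algHom_apply, aeval_diagonal]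
  simp [hf]

open scoped MatrixOrder in
theorem exists_conjTranspose_mul_self {K : Matrix (Fin n) (Fin n) ℂ} (hK : K.PosSemidef) :
    ∃ R : Matrix (Fin n) (Fin n) ℂ, K = Rᴴ * R := by
  obtain ⟨R, hR, -, rfl⟩ := CFC.exists_sqrt_of_isSelfAdjoint_of_quasispectrumRestricts
    hK.isHermitian (QuasispectrumRestricts.nnreal_of_nonneg hK.nonneg)
  exact ⟨R, by rw [show Rᴴ = R from hR]⟩

theorem aeval_intertwine {m : Type*} [Fintype m] [DecidableEq m] {B C L : Matrix m m ℂ}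
    (h : B * L = L * C) (f : ℂ[X]) : aeval B f * L = L * aeval C f := by
  induction f using Polynomial.induction_on' with
  | add p q hp hq => rw [map_add, map_add, add_mul, mul_add, hp, hq]
  | monomial k a =>
    have hk : B ^ k * L = L * C ^ k := by
      induction k with
      | zero => simp
      | succ k ih => rw [pow_succ, mul_assoc, h, ← mul_assoc, ih, mul_assoc, ← pow_succ]
    rw [aeval_monomial, aeval_monomial, mul_assoc, hk, ← mul_assoc, ← mul_assoc,
      Algebra.commutes]

/-- A matrix that is nonnegative for an indefinite inner product has real eigenvalues, the nonzero
ones are semisimple, and the Jordan blocks at zero have size at most two. -/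
theorem exists_annihilator {H B : Matrix (Fin n) (Fin n) ℂ} (hH : H.IsHermitian) (hHinv : IsUnit H)
    (hB : IsHNonnegative H B) :
    ∃ g : ℂ[X], g.Separable ∧ g.eval 0 ≠ 0 ∧ (∀ z, g.eval z = 0 → z.im = 0) ∧
      aeval B (X ^ 2 * g) = 0 := by
  obtain ⟨R, hR⟩ := exists_conjTranspose_mul_self (posSemidef_of_isHNonnegative hB)
  have hdet : IsUnit H.det := (Matrix.isUnit_iff_isUnit_det H).1 hHinv
  have hBL : B = H⁻¹ * Rᴴ * R := by
    rw [mul_assoc, ← hR, ← mul_assoc, Matrix.nonsing_inv_mul _ hdet, one_mul]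
  have hC : (R * H⁻¹ * Rᴴ).IsHermitian := Matrix.isHermitian_mul_mul_conjTranspose _ hH.inv
  -- Each nonzero eigenvalue is taken once, which makes the product separable. The factor `X` in
  -- `hann` handles the eigenvalue zero.
  let Λ : Finset ℂ := (Finset.univ.image fun i => (hC.eigenvalues i : ℂ)).erase 0
  have hroot : ∀ z, (∏ c ∈ Λ, (X - C c)).eval z = 0 ↔ z ∈ Λ := fun z => by
    rw [Polynomial.eval_prod, Finset.prod_eq_zero_iff]
    simp [sub_eq_zero]
  have hann : aeval (R * H⁻¹ * Rᴴ) (X * ∏ c ∈ Λ, (X - C c)) = 0 := by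
    refine aeval_isHermitian_eq_zero hC fun i => ?_
    rw [eval_mul, eval_X, mul_eq_zero, hroot]
    by_cases hi : (hC.eigenvalues i : ℂ) = 0
    · exact Or.inl hi
    · exact Or.inr (Finset.mem_erase.2 ⟨hi, Finset.mem_image_of_mem _ (Finset.mem_univ i)⟩)
  refine ⟨∏ c ∈ Λ, (X - C c), ?_, ?_, fun z hz => ?_, ?_⟩
  · exact separable_prod_X_sub_C_iff'.2 fun _ _ _ _ h => h
  · rw [Ne, hroot]
    exact Finset.notMem_erase _ _
  · obtain ⟨-, hz⟩ := Finset.mem_erase.1 ((hroot z).1 hz)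
    obtain ⟨i, -, rfl⟩ := Finset.mem_image.1 hz
    exact Complex.ofReal_im _
  · have hint : B * (H⁻¹ * Rᴴ) = H⁻¹ * Rᴴ * (R * H⁻¹ * Rᴴ) := by
      rw [hBL]; simp only [mul_assoc]
    rw [pow_two, mul_assoc, mul_comm, map_mul, aeval_X]
    have h : ∀ M, M * B = M * (H⁻¹ * Rᴴ) * R := fun M => by rw [mul_assoc, ← hBL]
    rw [h, aeval_intertwine hint, hann, mul_zero, zero_mul]

end Annihilator

/-! ### Block sizes of the matrix and of its square roots -/

section SizeBounds

/-- A nonzero `c` is at most a simple root of `X ^ a * G`, and root multiplicity bounds the block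
size. -/
theorem jordanBlock_size_le_one {k a : ℕ} {c : ℂ} {G : ℂ[X]} (hc : c ≠ 0)
    (hG : G.eval c = 0 → (derivative G).eval c ≠ 0)
    (h : aeval (jordanBlock k c) (X ^ a * G) = 0) : k ≤ 1 := by
  have hG0 : G ≠ 0 := by
    rintro rfl
    simp at hG
  have hF0 : X ^ a * G ≠ 0 := mul_ne_zero (pow_ne_zero _ X_ne_zero) hG0
  have hm : (X ^ a * G).rootMultiplicity c ≤ 1 := by
    by_contra! hlt
    obtain ⟨h1, h2⟩ := (one_lt_rootMultiplicity_iff_isRoot hF0).1 hlt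
    have h3 : G.eval c = 0 := by simpa [hc] using h1
    refine hG h3 ?_
    simpa [Polynomial.IsRoot, h3, hc] using h2
  obtain ⟨q, hq, hndvd⟩ := exists_eq_pow_rootMultiplicity_mul_and_not_dvd _ hF0 c
  rw [dvd_iff_isRoot] at hndvd
  rw [hq] at h
  exact (jordanBlock_size_le hndvd h).trans hm

theorem jordanBlock_size_le_of_eval_zero {k a : ℕ} {G : ℂ[X]} (hG : G.eval 0 ≠ 0)
    (h : aeval (jordanBlock k 0) (X ^ a * G) = 0) : k ≤ a := by
  refine jordanBlock_size_le hG ?_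
  simpa using h

/-- By the chain rule the derivative at `c` is `2 * c * g'(c ^ 2)`. It can vanish at a root only if
`c = 0`. -/
theorem comp_sq_simple_roots {g : ℂ[X]} (hg : g.Separable) {c : ℂ} (hc : c ≠ 0)
    (h : (g.comp (X ^ 2)).eval c = 0) : (derivative (g.comp (X ^ 2))).eval c ≠ 0 := by
  have h1 : g.eval (c ^ 2) = 0 := by simpa using h
  have h2 : (derivative g).eval (c ^ 2) ≠ 0 := hg.eval₂_derivative_ne_zero (RingHom.id ℂ) h1
  simpa [derivative_comp, hc] using h2

variable {n : ℕ} {ι : Type*} [Fintype ι] [DecidableEq ι]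

/-- The sizes of the Jordan blocks of a matrix with annihilating polynomial `X² g`. -/
theorem sizes_of_annihilator {B : Matrix (Fin n) (Fin n) ℂ} {g : ℂ[X]} (hg : g.Separable)
    (hg0 : g.eval 0 ≠ 0) (hann : aeval B (X ^ 2 * g) = 0) {k : ι → ℕ} {c : ι → ℂ}
    (h : Similar B (jordanSum k c)) (i : ι) :
    (c i ≠ 0 → k i ≤ 1) ∧ (c i = 0 → k i ≤ 2) := by
  have h1 := h.aeval (X ^ 2 * g)
  rw [hann] at h1
  have h2 := aeval_jordanBlock_eq_zero h1.eq_zero i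
  refine ⟨fun hc => jordanBlock_size_le_one hc
    (fun hr => hg.eval₂_derivative_ne_zero (RingHom.id ℂ) hr) h2, fun hc => ?_⟩
  rw [hc] at h2
  exact jordanBlock_size_le_of_eval_zero hg0 h2

/-- The sizes of the Jordan blocks of a square root of a matrix with annihilating polynomial
`X² g`. -/
theorem root_sizes_of_annihilator {A : Matrix (Fin n) (Fin n) ℂ} {g : ℂ[X]} (hg : g.Separable)
    (hg0 : g.eval 0 ≠ 0) (hann : aeval (A ^ 2) (X ^ 2 * g) = 0) {k : ι → ℕ} {c : ι → ℂ}
    (h : Similar A (jordanSum k c)) (i : ι) :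
    (c i ≠ 0 → k i ≤ 1) ∧ (c i = 0 → k i ≤ 4) := by
  have h0 : aeval A (X ^ 4 * g.comp (X ^ 2)) = 0 := by
    have : (X ^ 4 * g.comp (X ^ 2) : ℂ[X]) = (X ^ 2 * g).comp (X ^ 2) := by
      rw [mul_comp, X_pow_comp, ← pow_mul]
    rw [this, aeval_comp]
    simpa using hann
  have h1 := h.aeval (X ^ 4 * g.comp (X ^ 2))
  rw [h0] at h1
  have h2 := aeval_jordanBlock_eq_zero h1.eq_zero i
  refine ⟨fun hc => jordanBlock_size_le_one hc (comp_sq_simple_roots hg hc) h2, fun hc => ?_⟩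
  rw [hc] at h2
  exact jordanBlock_size_le_of_eval_zero (by simpa using hg0) h2

end SizeBounds

/-! ### Square roots of `J_a(0) ⊕ J_b(0)` -/

section Pairs

/-- The pairs that occur in a Segre pairing, with members at most two. -/
def IsSmallPair (p : ℕ × ℕ) : Prop :=
  p = (1, 0) ∨ p = (1, 1) ∨ p = (2, 1) ∨ p = (2, 2)

theorem isSmallPair_of_le {p : ℕ × ℕ} (h : p.1 ≠ 0 ∧ p.2 ≤ p.1 ∧ p.1 ≤ p.2 + 1) (h2 : p.1 ≤ 2) :
    IsSmallPair p := by
  obtain ⟨a, b⟩ := p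
  simp only [IsSmallPair, Prod.mk.injEq] at *
  omega

/-- The bijection that sends the two chains of `J_a(0) ⊕ J_b(0)` to the even and odd vectors of
the chain of `J_{a+b}(0)`. -/
def interleave (p : ℕ × ℕ) (h : p.2 ≤ p.1 ∧ p.1 ≤ p.2 + 1) :
    Fin (p.1 + p.2) ≃ Fin p.1 ⊕ Fin p.2 where
  toFun x := if hx : (x : ℕ) % 2 = 0 then .inl ⟨x / 2, by omega⟩ else .inr ⟨x / 2, by omega⟩
  invFun := Sum.elim (fun i => ⟨2 * i, by omega⟩) fun i => ⟨2 * i + 1, by omega⟩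
  left_inv x := by
    dsimp only
    split_ifs <;> simp [Fin.ext_iff] <;> omega
  right_inv := by
    rintro (i | i)
    · simp
    · simp [Fin.ext_iff]
      omega

/-- The square root of `J_a(0) ⊕ J_b(0)` that consists of a single Jordan chain. -/
def chainRoot (p : ℕ × ℕ) : Matrix (Fin p.1 ⊕ Fin p.2) (Fin p.1 ⊕ Fin p.2) ℂ :=
  Matrix.of fun x y => if Sum.elim (fun i : Fin p.1 => 2 * (i : ℕ))
    (fun i : Fin p.2 => 2 * (i : ℕ) + 1) x + 1 =
    Sum.elim (fun i : Fin p.1 => 2 * (i : ℕ)) (fun i : Fin p.2 => 2 * (i : ℕ) + 1) y then 1 else 0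

theorem jordanBlock_zero_apply (k : ℕ) (x y : Fin k) :
    jordanBlock k 0 x y = if (x : ℕ) + 1 = y then 1 else 0 := by
  simpa using jordanBlock_zero_pow_apply k 1 x y

theorem chainRoot_eq_submatrix (p : ℕ × ℕ) (h : p.2 ≤ p.1 ∧ p.1 ≤ p.2 + 1) :
    chainRoot p = (jordanBlock (p.1 + p.2) 0).submatrix (interleave p h).symm
      (interleave p h).symm := by
  ext (x | x) (y | y) <;> simp [chainRoot, interleave, jordanBlock_zero_apply] <;> congr

theorem chainRoot_similar (p : ℕ × ℕ) (h : p.2 ≤ p.1 ∧ p.1 ≤ p.2 + 1) :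
    Similar (chainRoot p) (jordanBlock (p.1 + p.2) 0) :=
  Similar.of_equiv (interleave p h) fun x y => by simp [chainRoot_eq_submatrix p h]

theorem chainRoot_mul_self (p : ℕ × ℕ) (h : p.2 ≤ p.1 ∧ p.1 ≤ p.2 + 1) :
    chainRoot p * chainRoot p = pairBlock p := by
  rw [chainRoot_eq_submatrix p h, Matrix.submatrix_mul_equiv, ← pow_two]
  ext (x | x) (y | y) <;>
    simp only [Matrix.submatrix_apply, jordanBlock_zero_pow_apply, interleave, pairBlock, dsum,
      Matrix.fromBlocks_apply₁₁, Matrix.fromBlocks_apply₁₂, Matrix.fromBlocks_apply₂₁,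
      Matrix.fromBlocks_apply₂₂, jordanBlock_zero_apply, Equiv.coe_fn_symm_mk, Sum.elim_inl,
      Sum.elim_inr, Matrix.zero_apply] <;>
    split_ifs <;> first | rfl | omega

theorem isPairRoot_chainRoot (p : ℕ × ℕ) (h : p.2 ≤ p.1 ∧ p.1 ≤ p.2 + 1) :
    IsPairRoot p (chainRoot p) := by
  refine ⟨chainRoot_mul_self p h, ?_⟩
  rintro rfl h0
  have := congrFun (congrFun h0 (.inl 0)) (.inr 0)
  simp [chainRoot] at this

theorem pairBlock_sq {p : ℕ × ℕ} (h : IsSmallPair p) : pairBlock p ^ 2 = 0 := by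
  rw [pairBlock, dsum_pow, jordanBlock_zero_pow_eq_zero, jordanBlock_zero_pow_eq_zero]
  · simp [dsum]
  all_goals rcases h with rfl | rfl | rfl | rfl <;> decide

theorem pairBlock_ne_zero {b : ℕ} : pairBlock (2, b) ≠ 0 := fun h => by
  have := congrFun (congrFun h (.inl 0)) (.inl 1)
  simp [pairBlock, dsum, jordanBlock] at this

/-- Every square root associated with a pair `(a, b)` is a single Jordan chain. -/
theorem IsPairRoot.similar {p : ℕ × ℕ} (hp : IsSmallPair p)
    {Y : Matrix (Fin p.1 ⊕ Fin p.2) (Fin p.1 ⊕ Fin p.2) ℂ} (h : IsPairRoot p Y) :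
    Similar Y (jordanBlock (p.1 + p.2) 0) := by
  obtain ⟨h1, h2⟩ := h
  rw [← pow_two] at h1
  have hnil : IsNilpotent Y := ⟨2 * 2, by rw [pow_mul, h1, pairBlock_sq hp]⟩
  -- It remains to see that `Y ^ (a + b - 1)` is nonzero. The exponents are 0, 1, 2, 3; exponent 1
  -- is where excluding the zero root of `(1, 1)` is needed, and exponent 2 is the pair block
  -- itself.
  refine similar_jordanBlock_of_cyclic hnil (by simp) fun _ => ?_
  rcases hp with rfl | rfl | rfl | rfl
  · simp
  · simpa using h2 rfl
  · simpa [h1] using pairBlock_ne_zero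
  -- If `Y ^ 3 = 0`, then `Y` is annihilated on both sides by `Y ^ 2 = J_2(0) ⊕ J_2(0)`. This clears
  -- the second row and the first column of every block of `Y`, so each product contributing to the
  -- entry of `Y ^ 2` that should be 1 has a zero factor.
  · intro h3
    have h3' : Y ^ 3 = 0 := h3
    have hl : pairBlock (2, 2) * Y = 0 := by rw [← h1, ← pow_succ, h3']
    have hr : Y * pairBlock (2, 2) = 0 := by rw [← h1, ← pow_succ', h3']
    have hrow : ∀ y, Y (.inl 1) y = 0 ∧ Y (.inr 1) y = 0 := fun y => by
      have a := congrFun (congrFun hl (.inl 0)) y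
      have b := congrFun (congrFun hl (.inr 0)) y
      simp [Matrix.mul_apply, pairBlock, dsum, jordanBlock_zero_apply, Fin.sum_univ_two] at a b
      exact ⟨a, b⟩
    have hcol : ∀ x, Y x (.inl 0) = 0 ∧ Y x (.inr 0) = 0 := fun x => by
      have a := congrFun (congrFun hr x) (.inl 1)
      have b := congrFun (congrFun hr x) (.inr 1)
      simp [Matrix.mul_apply, pairBlock, dsum, jordanBlock_zero_apply] at a b
      exact ⟨a, b⟩
    have h4 := congrFun (congrFun h1 (.inl 0)) (.inl 1)
    rw [pow_two, Matrix.mul_apply] at h4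
    simp [pairBlock, dsum, jordanBlock_zero_apply, Fin.sum_univ_two, (hrow _).1, (hrow _).2,
      (hcol _).1, (hcol _).2] at h4

end Pairs

/-! ### Splitting Jordan data at the eigenvalue zero -/

section Data

variable {ι κ : Type*} [Fintype ι] [DecidableEq ι] [Fintype κ] [DecidableEq κ]

theorem eq_diagonal_add_nilpotent_data {M : Multiset (ℕ × ℂ)} (h0 : ∀ z ∈ M, z.1 ≠ 0)
    (h : ∀ z ∈ M, z.2 ≠ 0 → z.1 ≤ 1) :
    M = ((M.filter fun z => z.2 ≠ 0).map Prod.snd).map (fun c => (1, c)) +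
      ((M.filter fun z => z.2 = 0).map Prod.fst).map (fun k => (k, 0)) := by
  conv_lhs => rw [← Multiset.filter_add_not (fun z : ℕ × ℂ => z.2 ≠ 0) M]
  rw [Multiset.map_map, Multiset.map_map]
  congr 1
  · conv_lhs => rw [← Multiset.map_id (M.filter fun z => z.2 ≠ 0)]
    refine Multiset.map_congr rfl fun z hz => ?_
    obtain ⟨hz, hz'⟩ := Multiset.mem_filter.1 hz
    have := h z hz hz'
    have := h0 z hz
    exact Prod.ext (by simp; omega) rfl
  · simp only [not_not]
    conv_lhs => rw [← Multiset.map_id (M.filter fun z => z.2 = 0)]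
    refine Multiset.map_congr rfl fun z hz => ?_
    exact Prod.ext rfl (Multiset.mem_filter.1 hz).2

theorem jordanData_one (ν : ι → ℂ) :
    jordanData (fun _ => 1) ν = (Finset.univ.val.map ν).map fun c => (1, c) := by
  simp [jordanData, Multiset.map_map, Multiset.filter_eq_self]

theorem jordanData_zero {k : ι → ℕ} (h : ∀ i, k i ≠ 0) :
    jordanData k (fun _ => 0) = (Finset.univ.val.map k).map fun j => (j, 0) := by
  rw [jordanData, Multiset.map_map, Multiset.filter_eq_self.2]
  · rfl
  · simpa using h

theorem mem_jordanData {k : ι → ℕ} {c : ι → ℂ} {z : ℕ × ℂ} (h : z ∈ jordanData k c) :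
    z.1 ≠ 0 ∧ ∃ i, k i = z.1 ∧ c i = z.2 := by
  obtain ⟨h1, h2⟩ := Multiset.mem_filter.1 h
  obtain ⟨i, -, rfl⟩ := Multiset.mem_map.1 h1
  exact ⟨h2, i, rfl, rfl⟩

theorem jordanData_diagonal_nilpotent (ν : ι → ℂ) {k : κ → ℕ} (h : ∀ i, k i ≠ 0) :
    jordanData (Sum.elim (fun _ => 1) k) (Sum.elim ν fun _ => 0) =
      (Finset.univ.val.map ν).map (fun c => (1, c)) +
        (Finset.univ.val.map k).map fun j => (j, 0) := by
  rw [jordanData_sum, jordanData_one, jordanData_zero h]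

theorem dsum_diagonal_similar (ν : ι → ℂ) (k : κ → ℕ) :
    Similar (dsum (diagonal ν) (jordanSum k fun _ => 0))
      (jordanSum (Sum.elim (fun _ => 1) k) (Sum.elim ν fun _ => 0)) :=
  ((diagonal_similar ν).dsum (Similar.refl _)).trans (jordanSum_sum _ _ _ _)

/-- A Jordan sum whose blocks at nonzero eigenvalues have size one is similar to the direct sum of
an invertible diagonal matrix and a nilpotent one. -/
theorem exists_similar_diagonal_nilpotent {k : ι → ℕ} {c : ι → ℂ} (h : ∀ i, c i ≠ 0 → k i ≤ 1) :
    ∃ (d N : ℕ) (ν : Fin d → ℂ) (s : Fin N → ℕ), (∀ i, ν i ≠ 0) ∧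
      (∀ j, s j ≠ 0 ∧ ∃ i, c i = 0 ∧ k i = s j) ∧
      Similar (jordanSum k c) (dsum (diagonal ν) (jordanSum s fun _ => 0)) := by
  obtain ⟨d, ν, hν⟩ := exists_fin_map_eq (((jordanData k c).filter fun z => z.2 ≠ 0).map Prod.snd)
  obtain ⟨N, s, hs⟩ := exists_fin_map_eq (((jordanData k c).filter fun z => z.2 = 0).map Prod.fst)
  have hs' : ∀ j, s j ≠ 0 ∧ ∃ i, c i = 0 ∧ k i = s j := fun j => by
    have hj : s j ∈ Finset.univ.val.map s := Multiset.mem_map_of_mem s (Finset.mem_univ j)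
    rw [hs] at hj
    obtain ⟨z, hz, hzj⟩ := Multiset.mem_map.1 hj
    obtain ⟨hz, hz0⟩ := Multiset.mem_filter.1 hz
    obtain ⟨h0, i, hi, hi'⟩ := mem_jordanData hz
    exact ⟨hzj ▸ h0, i, hi'.trans hz0, hi.trans hzj⟩
  refine ⟨d, N, ν, s, fun i hi => ?_, hs', ?_⟩
  · have hj : ν i ∈ Finset.univ.val.map ν := Multiset.mem_map_of_mem ν (Finset.mem_univ i)
    rw [hν, hi] at hj
    obtain ⟨z, hz, hzj⟩ := Multiset.mem_map.1 hj
    exact (Multiset.mem_filter.1 hz).2 hzj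
  · refine Similar.trans (similar_of_jordanData_eq ?_) (dsum_diagonal_similar ν s).symm
    rw [jordanData_diagonal_nilpotent ν fun j => (hs' j).1, hν, hs]
    refine eq_diagonal_add_nilpotent_data (fun z hz => (mem_jordanData hz).1) fun z hz hz0 => ?_
    obtain ⟨-, i, hi, hi'⟩ := mem_jordanData hz
    exact hi ▸ h i (hi' ▸ hz0)

/-- The Segre characteristic demands positive block sizes; passing to `jordanData` discards the
empty blocks that arise from pairs `(a, 0)`. -/
theorem isSegreCharacteristic_of_similar {n : ℕ} {B : Matrix (Fin n) (Fin n) ℂ} {k : ι → ℕ}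
    {c : ι → ℂ} (h : Similar B (jordanSum k c)) (z : ℂ) :
    IsSegreCharacteristic B z (((jordanData k c).filter fun x => x.2 = z).map Prod.fst) := by
  obtain ⟨r, f, hf⟩ := exists_fin_map_eq (jordanData k c)
  have hpos : ∀ i, (f i).1 ≠ 0 := fun i => by
    have : f i ∈ Finset.univ.val.map f := Multiset.mem_map_of_mem f (Finset.mem_univ i)
    rw [hf] at this
    exact (mem_jordanData this).1
  refine ⟨r, fun i => (f i).1, fun i => (f i).2, fun i => Nat.pos_of_ne_zero (hpos i),
    h.trans (similar_of_jordanData_eq ?_), ?_⟩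
  · rw [← hf, jordanData, Multiset.filter_eq_self.2]
    simpa using hpos
  · rw [← hf, Multiset.filter_map, Multiset.map_map]
    rfl

theorem pairBlocks_similar {N : ℕ} (p : Fin N → ℕ × ℕ) :
    Similar (blockDiagonal' fun i => pairBlock (p i))
      (jordanSum (Sum.elim (fun i => (p i).1) fun i => (p i).2) fun _ => 0) := by
  refine Similar.trans (Similar.of_equiv
    { toFun := fun x => Sum.rec (motive := fun _ => Σ i, (Fin (p i).1 ⊕ Fin (p i).2))
        (fun y => ⟨y.1, .inl y.2⟩) (fun y => ⟨y.1, .inr y.2⟩) x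
      invFun := fun x => match x with
        | ⟨i, .inl a⟩ => .inl ⟨i, a⟩
        | ⟨i, .inr a⟩ => .inr ⟨i, a⟩
      left_inv := by rintro (x | x) <;> rfl
      right_inv := by rintro ⟨i, a | a⟩ <;> rfl }
    (J := dsum (jordanSum (fun i => (p i).1) fun _ => 0)
        (jordanSum (fun i => (p i).2) fun _ => 0)) ?_) ?_
  · rintro (⟨i, a⟩ | ⟨i, a⟩) (⟨j, b⟩ | ⟨j, b⟩) <;>
    · simp only [Matrix.blockDiagonal'_apply, dsum, Matrix.fromBlocks_apply₁₁,
        Matrix.fromBlocks_apply₁₂, Matrix.fromBlocks_apply₂₁, Matrix.fromBlocks_apply₂₂,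
        Equiv.coe_fn_mk, jordanSum, Matrix.zero_apply]
      by_cases h : i = j
      · subst h
        simp [pairBlock, dsum]
      · simp [h]
  · refine (jordanSum_sum _ _ _ _).trans (jordanSum_reindex (Equiv.refl _) (fun _ => rfl) ?_)
    rintro (i | i) <;> rfl

end Data

/-! ### Segre pairings and associated square roots -/

section Association

variable {n d N : ℕ} {A B : Matrix (Fin n) (Fin n) ℂ} {ν : Fin d → ℂ} {p : Fin N → ℕ × ℕ}

theorem IsSmallPair.balanced {p : ℕ × ℕ} (h : IsSmallPair p) : p.2 ≤ p.1 ∧ p.1 ≤ p.2 + 1 := by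
  rcases h with rfl | rfl | rfl | rfl <;> decide

theorem IsSmallPair.fst_ne_zero {p : ℕ × ℕ} (h : IsSmallPair p) : p.1 ≠ 0 := by
  rcases h with rfl | rfl | rfl | rfl <;> decide

/-- A pair of numbers that differ by at most one is determined by its sum. -/
theorem eq_of_sum {p : ℕ × ℕ} (h : p.2 ≤ p.1 ∧ p.1 ≤ p.2 + 1) :
    ((p.1 + p.2 + 1) / 2, (p.1 + p.2) / 2) = p := by
  obtain ⟨a, b⟩ := p
  simp only [Prod.mk.injEq] at *
  omega

theorem similar_dsum_chainRoots {l : Type*} [Fintype l] [DecidableEq l] {A : Matrix l l ℂ}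
    (hp : ∀ i, IsSmallPair (p i))
    (h : Similar A (dsum (diagonal ν) (jordanSum (fun i => (p i).1 + (p i).2) fun _ => 0))) :
    Similar A (dsum (diagonal ν) (blockDiagonal' fun i => chainRoot (p i))) :=
  h.trans ((Similar.refl _).dsum
    (blockDiagonal'_similar fun i => chainRoot_similar (p i) (hp i).balanced).symm)

/-- Interleaving replaces each chain of length `a + b` by `chainRoot`; in the same basis the square
is then automatically a sum of pair blocks. -/
theorem isAssociatedWith_of_similar (hA : A * A = B) (hν : ∀ i, ν i ≠ 0)
    (hp : ∀ i, IsSmallPair (p i))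
    (h : Similar A (dsum (diagonal ν) (jordanSum (fun i => (p i).1 + (p i).2) fun _ => 0))) :
    IsAssociatedWith A B (Finset.univ.val.map p) := by
  obtain ⟨P, Q, hPQ, hQ⟩ := similar_dsum_chainRoots hp h
  refine ⟨d, N, diagonal ν, diagonal ν * diagonal ν, p, fun i => chainRoot (p i), P, Q, hPQ, rfl,
    ?_, rfl, fun i => isPairRoot_chainRoot _ (hp i).balanced, ?_, hQ⟩
  · have : IsUnit (diagonal ν) := by
      rw [Matrix.isUnit_iff_isUnit_det, Matrix.det_diagonal, isUnit_iff_ne_zero]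
      exact Finset.prod_ne_zero_iff.2 fun i _ => hν i
    exact this.mul this
  · rw [← hA, MutuallyInverse.conj_mul hPQ, hQ, dsum_mul, ← Matrix.blockDiagonal'_mul]
    congr 2
    funext i
    exact chainRoot_mul_self _ (hp i).balanced

theorem sq_similar_jordanSum {l : Type*} [Fintype l] [DecidableEq l] {A : Matrix l l ℂ}
    (hp : ∀ i, IsSmallPair (p i))
    (h : Similar A (dsum (diagonal ν) (jordanSum (fun i => (p i).1 + (p i).2) fun _ => 0))) :
    Similar (A * A) (jordanSum
      (Sum.elim (fun _ => 1) (Sum.elim (fun i => (p i).1) fun i => (p i).2))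
      (Sum.elim (fun i => ν i * ν i) fun _ => 0)) := by
  refine (similar_dsum_chainRoots hp h).mul_self.trans ?_
  have hsq : (fun i => chainRoot (p i) * chainRoot (p i)) = fun i => pairBlock (p i) :=
    funext fun i => chainRoot_mul_self _ (hp i).balanced
  rw [dsum_mul, ← Matrix.blockDiagonal'_mul, Matrix.diagonal_mul_diagonal, hsq]
  exact ((Similar.refl _).dsum (pairBlocks_similar p)).trans (dsum_diagonal_similar _ _)

theorem sq_jordanData (hp : ∀ i, IsSmallPair (p i)) :
    jordanData (Sum.elim (fun _ => 1) (Sum.elim (fun i => (p i).1) fun i => (p i).2))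
      (Sum.elim (fun i => ν i * ν i) fun _ => 0) =
    (Finset.univ.val.map fun i => ν i * ν i).map (fun c => (1, c)) +
      ((Finset.univ.val.map p).map Prod.fst +
        ((Finset.univ.val.map p).map Prod.snd).filter fun a => a ≠ 0).map fun k => (k, 0) := by
  rw [jordanData_sum, jordanData_one]
  congr 1
  rw [jordanData, map_univ_sum, Multiset.filter_add, Multiset.filter_eq_self.2, Multiset.map_add]
  · congr 1
    · rw [Multiset.map_map, Multiset.map_map]
      rfl
    · rw [Multiset.map_map, Multiset.filter_map, Multiset.filter_map, Multiset.map_map]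
      rfl
  · simp only [Multiset.mem_map]
    rintro _ ⟨i, -, rfl⟩
    exact (hp i).fst_ne_zero

theorem isSegrePairingOf_of_similar (hA : A * A = B) (hν : ∀ i, ν i ≠ 0)
    (hp : ∀ i, IsSmallPair (p i))
    (h : Similar A (dsum (diagonal ν) (jordanSum (fun i => (p i).1 + (p i).2) fun _ => 0))) :
    IsSegrePairingOf B (Finset.univ.val.map p) := by
  have h1 := isSegreCharacteristic_of_similar (hA ▸ sq_similar_jordanSum hp h) 0
  rw [sq_jordanData hp, Multiset.filter_add, Multiset.filter_eq_nil.2, Multiset.filter_eq_self.2,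
    zero_add, Multiset.map_map] at h1
  · refine ⟨_, h1, ?_, fun q hq => ?_⟩
    · exact (Multiset.map_id _).symm
    · obtain ⟨i, -, rfl⟩ := Multiset.mem_map.1 hq
      exact ⟨(hp i).fst_ne_zero, (hp i).balanced⟩
  · intro z hz
    obtain ⟨k, -, rfl⟩ := Multiset.mem_map.1 hz
    rfl
  · intro z hz
    obtain ⟨c, hc, rfl⟩ := Multiset.mem_map.1 hz
    obtain ⟨i, -, rfl⟩ := Multiset.mem_map.1 hc
    exact mul_ne_zero (hν i) (hν i)

/-- The larger member of a pair is a block size of `B` at zero, hence at most 2, and only four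
balanced pairs remain. -/
theorem isSmallPair_of_isSegrePairingOf {g : ℂ[X]} (hg : g.Separable)
    (hg0 : g.eval 0 ≠ 0) (hann : aeval B (X ^ 2 * g) = 0) {S : Multiset (ℕ × ℕ)}
    (hS : IsSegrePairingOf B S) : ∀ q ∈ S, IsSmallPair q := by
  obtain ⟨s, ⟨r, k, ev, -, hsim, rfl⟩, hS1, hS2⟩ := hS
  intro q hq
  refine isSmallPair_of_le (hS2 q hq) ?_
  have h1 : q.1 ∈ S.map Prod.fst + (S.map Prod.snd).filter fun a => a ≠ 0 :=
    Multiset.mem_add.2 (Or.inl (Multiset.mem_map_of_mem _ hq))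
  rw [hS1] at h1
  obtain ⟨i, hi, hiq⟩ := Multiset.mem_map.1 h1
  rw [Finset.mem_val, Finset.mem_filter] at hi
  rw [← hiq]
  exact (sizes_of_annihilator hg hg0 hann hsim i).2 hi.2

/-- A square root associated with a Segre pairing consists of an invertible part and of one chain
of length `a + b` for every pair `(a, b)`. -/
theorem IsAssociatedWith.exists_similar {S : Multiset (ℕ × ℕ)} (h : IsAssociatedWith A B S)
    (hS : ∀ q ∈ S, IsSmallPair q) :
    ∃ (d N : ℕ) (A' : Matrix (Fin d) (Fin d) ℂ) (p : Fin N → ℕ × ℕ), IsUnit A' ∧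
      Finset.univ.val.map p = S ∧
      Similar A (dsum A' (jordanSum (fun i => (p i).1 + (p i).2) fun _ => 0)) := by
  obtain ⟨d, N, A', B', p, Y, P, Q, hPQ, hpS, hB', hA', hY, -, hA⟩ := h
  refine ⟨d, N, A', p, ?_, hpS, ?_⟩
  · rw [← hA'] at hB'
    exact isUnit_of_mul_isUnit_left hB'
  · refine Similar.trans ⟨P, Q, hPQ, hA⟩
      ((Similar.refl _).dsum (blockDiagonal'_similar fun i => ?_))
    refine (hY i).similar (hS _ ?_)
    rw [← hpS]
    exact Multiset.mem_map_of_mem p (Finset.mem_univ i)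

/-- Both pairings have as their sums `a + b` the nilpotent block sizes of `A`, and a balanced pair
is determined by its sum. -/
theorem IsAssociatedWith.unique {S S' : Multiset (ℕ × ℕ)} (h : IsAssociatedWith A B S)
    (h' : IsAssociatedWith A B S') (hS : ∀ q ∈ S, IsSmallPair q) (hS' : ∀ q ∈ S', IsSmallPair q) :
    S = S' := by
  obtain ⟨d, N, A', p, hA', hp, hsim⟩ := h.exists_similar hS
  obtain ⟨d', N', A'', p', hA'', hp', hsim'⟩ := h'.exists_similar hS'
  have hsmall : ∀ i, IsSmallPair (p i) := fun i =>
    hS _ (hp ▸ Multiset.mem_map_of_mem p (Finset.mem_univ i))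
  have hsmall' : ∀ i, IsSmallPair (p' i) := fun i =>
    hS' _ (hp' ▸ Multiset.mem_map_of_mem p' (Finset.mem_univ i))
  have key := nilpotent_sizes_unique hA' hA'' (fun i => by have := (hsmall i).fst_ne_zero; omega)
    (fun i => by have := (hsmall' i).fst_ne_zero; omega) (hsim.symm.trans hsim')
  have hrec : ∀ {N : ℕ} {p : Fin N → ℕ × ℕ}, (∀ i, IsSmallPair (p i)) →
      Finset.univ.val.map p = (Finset.univ.val.map fun i => (p i).1 + (p i).2).map
        fun m => ((m + 1) / 2, m / 2) := fun {N p} hp => by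
    rw [Multiset.map_map]
    exact Multiset.map_congr rfl fun i _ => (eq_of_sum (hp i).balanced).symm
  rw [← hp, ← hp', hrec hsmall, hrec hsmall', key]

/-- Every square root is associated with a Segre pairing. -/
theorem exists_isAssociatedWith (hA : A * A = B) {g : ℂ[X]} (hg : g.Separable)
    (hg0 : g.eval 0 ≠ 0) (hann : aeval B (X ^ 2 * g) = 0) :
    ∃ S : Multiset (ℕ × ℕ), IsSegrePairingOf B S ∧ IsAssociatedWith A B S := by
  obtain ⟨r, k, c, hkc⟩ := exists_similar_jordanSum A
  have hsz := root_sizes_of_annihilator hg hg0 (by rwa [pow_two, hA]) hkc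
  obtain ⟨d, N, ν, s, hν, hs, hsim⟩ := exists_similar_diagonal_nilpotent fun i => (hsz i).1
  -- The even and odd positions of a chain of length `s i`; the bound `s i ≤ 4` keeps both members
  -- at most 2.
  let p : Fin N → ℕ × ℕ := fun i => ((s i + 1) / 2, s i / 2)
  have hp : ∀ i, IsSmallPair (p i) := fun i => by
    obtain ⟨h0, j, hj, hj'⟩ := hs i
    have h4 := (hsz j).2 hj
    rw [hj'] at h4
    exact isSmallPair_of_le (by simp only [p]; omega) (by simp only [p]; omega)
  have hsp : s = fun i => (p i).1 + (p i).2 := funext fun i => by simp only [p]; omega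
  have h := hkc.trans hsim
  rw [hsp] at h
  exact ⟨_, isSegrePairingOf_of_similar hA hν hp h, isAssociatedWith_of_similar hA hν hp h⟩

end Association

/-! ### Nonzero eigenvalues and the choice of signs -/

section Eigenvalues

variable {n d N q m : ℕ} {A B : Matrix (Fin n) (Fin n) ℂ} {ν : Fin d → ℂ} {p : Fin N → ℕ × ℕ}
  {pos : Fin q → ℝ} {neg : Fin m → ℝ}

theorem roots_charpoly_of_similar {ι : Type*} [Fintype ι] [DecidableEq ι] {ν : Fin d → ℂ}
    {Z : Matrix ι ι ℂ} (hZ : IsNilpotent Z) (hν : ∀ i, ν i ≠ 0)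
    (h : Similar B (dsum (diagonal ν) Z)) :
    B.charpoly.roots.filter (fun z => z ≠ 0) = Finset.univ.val.map ν := by
  have hprod : ∏ i, (X - C (ν i)) ≠ 0 :=
    Finset.prod_ne_zero_iff.2 fun i _ => X_sub_C_ne_zero (ν i)
  rw [h.charpoly_eq, dsum, Matrix.charpoly_fromBlocks_zero₁₂, Matrix.charpoly_diagonal,
    charpoly_of_isNilpotent hZ, roots_mul (mul_ne_zero hprod (pow_ne_zero _ X_ne_zero)),
    roots_prod _ _ hprod, Multiset.filter_add, roots_X_pow]
  simp only [roots_X_sub_C, Multiset.bind_singleton]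
  rw [Multiset.filter_eq_self.2, Multiset.filter_eq_nil.2, add_zero]
  · intro z hz
    rw [Multiset.mem_nsmul] at hz
    simpa using hz.2
  · intro z hz
    obtain ⟨i, -, rfl⟩ := Multiset.mem_map.1 hz
    exact hν i

theorem roots_charpoly_of_jordanData {ι : Type*} [Fintype ι] [DecidableEq ι] {k : ι → ℕ}
    {c : ι → ℂ} (h : Similar B (jordanSum k c)) {L : Multiset ℂ} {K : Multiset ℕ}
    (hL : ∀ z ∈ L, z ≠ 0)
    (hdata : jordanData k c = L.map (fun z => (1, z)) + K.map fun j => (j, 0)) :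
    B.charpoly.roots.filter (fun z => z ≠ 0) = L := by
  obtain ⟨d, ν, rfl⟩ := exists_fin_map_eq L
  obtain ⟨N, s, rfl⟩ := exists_fin_map_eq K
  have hs : ∀ i, s i ≠ 0 := fun i => by
    have : (s i, (0 : ℂ)) ∈ jordanData k c := by
      rw [hdata]
      exact Multiset.mem_add.2 (Or.inr (Multiset.mem_map_of_mem (fun j => (j, (0 : ℂ)))
        (Multiset.mem_map_of_mem s (Finset.mem_univ i))))
    exact (mem_jordanData this).1
  refine roots_charpoly_of_similar (isNilpotent_jordanSum s)
    (fun i => hL _ (Multiset.mem_map_of_mem ν (Finset.mem_univ i))) (h.trans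
      ((similar_of_jordanData_eq ?_).trans (dsum_diagonal_similar ν s).symm))
  rw [hdata, jordanData_diagonal_nilpotent ν hs]

/-- An invertible nilpotent matrix exists only in size zero. This removes the nilpotent summand from
the invertible part of a square root. -/
theorem isEmpty_of_isUnit_dsum {l ι : Type*} [Fintype l] [DecidableEq l] [Fintype ι]
    [DecidableEq ι] {D : Matrix l l ℂ} {Z : Matrix ι ι ℂ} (hZ : IsNilpotent Z)
    (h : IsUnit (dsum D Z)) : IsEmpty ι := by
  rw [Matrix.isUnit_iff_isUnit_det, dsum, Matrix.det_fromBlocks_zero₂₁] at h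
  have h' : IsUnit Z := (Matrix.isUnit_iff_isUnit_det Z).2 (isUnit_of_mul_isUnit_right h)
  by_contra hne
  rw [not_isEmpty_iff] at hne
  exact hZ.not_isUnit h'

theorem exists_fin_enumeration (s : Multiset ℂ) (h0 : ∀ z ∈ s, z ≠ 0 ∧ z.im = 0) :
    ∃ (q m : ℕ) (pos : Fin q → ℝ) (neg : Fin m → ℝ), (∀ j, 0 < pos j) ∧ (∀ j, neg j < 0) ∧
      s = Finset.univ.val.map (fun j => (pos j : ℂ)) +
        Finset.univ.val.map fun j => (neg j : ℂ) := by
  obtain ⟨q, pos, hpos⟩ := exists_fin_map_eq ((s.filter fun z => 0 < z.re).map Complex.re)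
  obtain ⟨m, neg, hneg⟩ := exists_fin_map_eq ((s.filter fun z => ¬ 0 < z.re).map Complex.re)
  have key : ∀ t ≤ s, (t.map Complex.re).map (fun x : ℝ => (x : ℂ)) = t := fun t ht => by
    rw [Multiset.map_map]
    conv_rhs => rw [← Multiset.map_id t]
    refine Multiset.map_congr rfl fun z hz => ?_
    exact Complex.ext rfl (h0 z (Multiset.mem_of_le ht hz)).2.symm
  refine ⟨q, m, pos, neg, fun j => ?_, fun j => ?_, ?_⟩
  · have hj : pos j ∈ Finset.univ.val.map pos := Multiset.mem_map_of_mem pos (Finset.mem_univ j)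
    rw [hpos] at hj
    obtain ⟨z, hz, hzj⟩ := Multiset.mem_map.1 hj
    exact hzj ▸ (Multiset.mem_filter.1 hz).2
  · have hj : neg j ∈ Finset.univ.val.map neg := Multiset.mem_map_of_mem neg (Finset.mem_univ j)
    rw [hneg] at hj
    obtain ⟨z, hz, hzj⟩ := Multiset.mem_map.1 hj
    obtain ⟨hz, hz'⟩ := Multiset.mem_filter.1 hz
    rw [← hzj]
    refine lt_of_le_of_ne (not_lt.1 hz') fun h => (h0 z hz).1 (Complex.ext h (h0 z hz).2)
  · have h1 := key _ (Multiset.filter_le (fun z => 0 < z.re) s)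
    have h2 := key _ (Multiset.filter_le (fun z => ¬ 0 < z.re) s)
    rw [← hpos, Multiset.map_map] at h1
    rw [← hneg, Multiset.map_map] at h2
    conv_lhs => rw [← Multiset.filter_add_not (fun z => 0 < z.re) s, ← h1, ← h2]
    rfl

/-- The nonzero eigenvalues of a matrix with a real annihilating polynomial are real. -/
theorem exists_enumeration {g : ℂ[X]} (hreal : ∀ z, g.eval z = 0 → z.im = 0)
    (hann : aeval B (X ^ 2 * g) = 0) :
    ∃ (q m : ℕ) (pos : Fin q → ℝ) (neg : Fin m → ℝ), EnumeratesNonzeroEigenvalues B pos neg := by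
  obtain ⟨q, m, pos, neg, h1, h2, h3⟩ := exists_fin_enumeration
    (B.charpoly.roots.filter fun z => z ≠ 0) fun z hz => by
      obtain ⟨hz, hz0⟩ := Multiset.mem_filter.1 hz
      refine ⟨hz0, hreal z ?_⟩
      -- An eigenvalue is a root of the minimal polynomial, hence of `X ^ 2 * g`; being nonzero, it
      -- is a root of `g`.
      have hev : Module.End.HasEigenvalue (Matrix.toLin' B) z := by
        rw [Module.End.hasEigenvalue_iff_isRoot_charpoly, Matrix.charpoly_toLin']
        exact isRoot_of_mem_roots hz
      have hmin := (Module.End.isRoot_of_hasEigenvalue hev).dvd (minpoly.dvd ℂ _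
        (show aeval (Matrix.toLin' B) (X ^ 2 * g) = 0 from ?_))
      · simpa [hz0] using hmin
      · have := Polynomial.aeval_algHom_apply
          (Matrix.toLinAlgEquiv' (R := ℂ) (n := Fin n)).toAlgHom B
          (X ^ 2 * g)
        rw [hann, map_zero] at this
        exact this
  exact ⟨q, m, pos, neg, h1, h2, h3⟩

theorem signed_sqrt_sq {x : ℝ} (hx : 0 ≤ x) (ε : ℤˣ) :
    (((ε : ℤ) : ℂ) * (Real.sqrt x : ℂ)) * (((ε : ℤ) : ℂ) * (Real.sqrt x : ℂ)) = x := by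
  have h : ((Real.sqrt x : ℝ) : ℂ) * (Real.sqrt x : ℂ) = x := by
    rw [← Complex.ofReal_mul, Real.mul_self_sqrt hx]
  have hε : ((ε : ℤ) : ℂ) * ((ε : ℤ) : ℂ) = 1 := by
    rcases Int.units_eq_one_or ε with rfl | rfl <;> simp
  linear_combination (x : ℂ) * hε + ((ε : ℤ) : ℂ) * ((ε : ℤ) : ℂ) * h

theorem signed_sqrt_neg_sq {x : ℝ} (hx : x ≤ 0) (ε : ℤˣ) :
    (Complex.I * ((ε : ℤ) : ℂ) * (Real.sqrt (-x) : ℂ)) *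
      (Complex.I * ((ε : ℤ) : ℂ) * (Real.sqrt (-x) : ℂ)) = x := by
  have h := signed_sqrt_sq (neg_nonneg.2 hx) ε
  rw [Complex.ofReal_neg] at h
  linear_combination (Complex.I * Complex.I) * h - (x : ℂ) * Complex.I_mul_I

theorem exists_sign {y w : ℂ} (h : y * y = w * w) : ∃ ε : ℤˣ, y = ((ε : ℤ) : ℂ) * w := by
  rcases mul_self_eq_mul_self_iff.1 h with h | h
  · exact ⟨1, by simp [h]⟩
  · exact ⟨-1, by simp [h]⟩

/-- The eigenvalues of a square root are signed roots of the eigenvalues. -/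
theorem exists_signs (hpos : ∀ j, 0 < pos j) (hneg : ∀ j, neg j < 0)
    (h : (Finset.univ.val.map fun i => ν i * ν i) =
      Finset.univ.val.map (fun j => (pos j : ℂ)) + Finset.univ.val.map fun j => (neg j : ℂ)) :
    ∃ (δ : Fin q → ℤˣ) (δ' : Fin m → ℤˣ), Finset.univ.val.map ν =
      Finset.univ.val.map (fun j => ((δ j : ℤ) : ℂ) * (Real.sqrt (pos j) : ℂ)) +
        Finset.univ.val.map fun j => Complex.I * ((δ' j : ℤ) : ℂ) * (Real.sqrt (-neg j) : ℂ) := by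
  have h' : (Finset.univ.val.map fun i => ν i * ν i) = Finset.univ.val.map
      (Sum.elim (fun j => (pos j : ℂ)) fun j => (neg j : ℂ)) := by
    rw [h, map_univ_sum]; rfl
  -- After matching indices, each `ν (e i)` and the standard root of the corresponding eigenvalue
  -- have equal squares, so they differ by a sign.
  obtain ⟨e, he⟩ := exists_equiv_of_map_univ_eq h'
  have hδ : ∀ j, ∃ ε : ℤˣ, ν (e (.inl j)) = ((ε : ℤ) : ℂ) * (Real.sqrt (pos j) : ℂ) := fun j => by
    refine exists_sign ?_
    rw [he, Sum.elim_inl]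
    simpa using (signed_sqrt_sq (hpos j).le 1).symm
  have hδ' : ∀ j, ∃ ε : ℤˣ, ν (e (.inr j)) =
      Complex.I * ((ε : ℤ) : ℂ) * (Real.sqrt (-neg j) : ℂ) := fun j => by
    obtain ⟨ε, hε⟩ := exists_sign (y := ν (e (.inr j)))
      (w := Complex.I * (Real.sqrt (-neg j) : ℂ)) (by
        rw [he, Sum.elim_inr]
        simpa using (signed_sqrt_neg_sq (hneg j).le 1).symm)
    exact ⟨ε, by rw [hε]; ring⟩
  choose δ hδ using hδ
  choose δ' hδ' using hδ'
  refine ⟨δ, δ', ?_⟩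
  rw [← Multiset.map_univ_val_equiv e, Multiset.map_map, map_univ_sum]
  simp only [Function.comp_apply, hδ, hδ']

end Eigenvalues

/-! ### Jordan forms of square roots and their construction -/

section RootForm

variable {n d N q m : ℕ} {A B : Matrix (Fin n) (Fin n) ℂ} {ν : Fin d → ℂ} {p : Fin N → ℕ × ℕ}
  {pos : Fin q → ℝ} {neg : Fin m → ℝ}

theorem eq_replicate_of_isSmallPair {S : Multiset (ℕ × ℕ)} (hS : ∀ x ∈ S, IsSmallPair x) :
    S = Multiset.replicate (S.count (1, 0)) (1, 0) + (Multiset.replicate (S.count (1, 1)) (1, 1) +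
      (Multiset.replicate (S.count (2, 1)) (2, 1) +
        Multiset.replicate (S.count (2, 2)) (2, 2))) := by
  ext x
  simp only [Multiset.count_add, Multiset.count_replicate]
  by_cases hx : x ∈ S
  · rcases hS x hx with rfl | rfl | rfl | rfl <;> simp
  · rw [Multiset.count_eq_zero_of_notMem hx]
    have h : ∀ y, (if y = x then S.count y else 0) = 0 := fun y => by
      split_ifs with hy
      · rw [hy, Multiset.count_eq_zero_of_notMem hx]
      · rfl
    simp [h]

/-- Both matrices are Jordan sums with the same data: the four small pairs have sums 1, 2, 3, 4, and
counting them gives the nilpotent blocks. -/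
theorem hasRootJordanForm_of_similar {δ : Fin q → ℤˣ} {δ' : Fin m → ℤˣ}
    (hp : ∀ i, IsSmallPair (p i)) (hν : Finset.univ.val.map ν =
      Finset.univ.val.map (fun j => ((δ j : ℤ) : ℂ) * (Real.sqrt (pos j) : ℂ)) +
        Finset.univ.val.map fun j => Complex.I * ((δ' j : ℤ) : ℂ) * (Real.sqrt (-neg j) : ℂ))
    (h : Similar A (dsum (diagonal ν) (jordanSum (fun i => (p i).1 + (p i).2) fun _ => 0))) :
    HasRootJordanForm A pos neg (Finset.univ.val.map p) δ δ' := by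
  refine (h.trans (dsum_diagonal_similar _ _)).trans (Similar.symm ?_)
  refine Similar.trans ((Similar.refl _).dsum
    ((((Similar.refl _).dsum (((Similar.refl _).dsum (jordanSum_sum _ _ _ _)).trans
      (jordanSum_sum _ _ _ _))).trans (jordanSum_sum _ _ _ _)).dsum (Similar.refl _)))
    (((Similar.refl _).dsum (jordanSum_sum _ _ _ _)).trans ((jordanSum_sum _ _ _ _).trans
      (similar_of_jordanData_eq ?_)))
  rw [jordanData_sum, jordanData_sum, jordanData_sum, jordanData_sum, jordanData_sum,
    jordanData_diagonal_nilpotent ν fun i => by have := (hp i).fst_ne_zero; omega, hν]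
  have hS := eq_replicate_of_isSmallPair (S := Finset.univ.val.map p) (by simpa using hp)
  have hsum : (Finset.univ.val.map fun i => (p i).1 + (p i).2) =
      (Finset.univ.val.map p).map fun x => x.1 + x.2 := by rw [Multiset.map_map]; rfl
  rw [hsum]
  conv_rhs => rw [hS]
  have hrep : ∀ l k : ℕ, k ≠ 0 → jordanData (fun _ : Fin l => k) (fun _ => (0 : ℂ)) =
      Multiset.replicate l (k, 0) := fun l k hk => by
    rw [jordanData_zero fun _ => hk]; simp
  rw [hrep _ _ (by decide), hrep _ _ (by decide), hrep _ _ (by decide), hrep _ _ (by decide),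
    jordanData_one, jordanData_one]
  simp only [Multiset.map_add, Multiset.map_replicate]
  abel

/-- A square root associated with a Segre pairing has the expected Jordan form. -/
theorem IsAssociatedWith.hasRootJordanForm (hA : A * A = B) {g : ℂ[X]} (hg : g.Separable)
    (hg0 : g.eval 0 ≠ 0) (hann : aeval B (X ^ 2 * g) = 0)
    (hen : EnumeratesNonzeroEigenvalues B pos neg) {S : Multiset (ℕ × ℕ)}
    (hS : IsSegrePairingOf B S) (h : IsAssociatedWith A B S) :
    ∃ (δ : Fin q → ℤˣ) (δ' : Fin m → ℤˣ), HasRootJordanForm A pos neg S δ δ' := by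
  have hsmall := isSmallPair_of_isSegrePairingOf hg hg0 hann hS
  obtain ⟨d, N, A', p, hA', rfl, hsim⟩ := h.exists_similar hsmall
  have hp : ∀ i, IsSmallPair (p i) := by simpa using hsmall
  obtain ⟨r, k, c, hkc⟩ := exists_similar_jordanSum A'
  -- Association says only that `A'` is invertible. Its blocks are also blocks of `A`, so those at
  -- nonzero eigenvalues have size one; as no nilpotent part can occur, `A'` is diagonalizable.
  have hsz := root_sizes_of_annihilator hg hg0 (by rwa [pow_two, hA])
    (hsim.trans ((hkc.dsum (Similar.refl _)).trans (jordanSum_sum _ _ _ _)))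
  obtain ⟨d', N', ν, s, hν, -, hνs⟩ := exists_similar_diagonal_nilpotent
    fun i => (hsz (.inl i)).1
  have hem := isEmpty_of_isUnit_dsum (isNilpotent_jordanSum s) ((hkc.trans hνs).isUnit hA')
  have hdiag : Similar A' (diagonal ν) := (hkc.trans hνs).trans
    (Similar.of_equiv (Equiv.sumEmpty _ _).symm fun i j => rfl)
  have hsim' := hsim.trans (hdiag.dsum (Similar.refl _))
  have hroots := roots_charpoly_of_jordanData (hA ▸ sq_similar_jordanSum hp hsim')
    (by simpa using hν) (sq_jordanData hp)
  obtain ⟨hpos, hneg, hev⟩ := hen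
  obtain ⟨δ, δ', hδ⟩ := exists_signs hpos hneg (hroots.symm.trans hev)
  exact ⟨δ, δ', hasRootJordanForm_of_similar hp hδ hsim'⟩

/-- Every choice of a Segre pairing and of signs comes from a square root. -/
theorem exists_root {g : ℂ[X]} (hg : g.Separable)
    (hg0 : g.eval 0 ≠ 0) (hann : aeval B (X ^ 2 * g) = 0)
    (hen : EnumeratesNonzeroEigenvalues B pos neg) {S : Multiset (ℕ × ℕ)}
    (hS : IsSegrePairingOf B S) (δ : Fin q → ℤˣ) (δ' : Fin m → ℤˣ) :
    ∃ A : Matrix (Fin n) (Fin n) ℂ, A ^ 2 = B ∧ IsAssociatedWith A B S ∧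
      HasRootJordanForm A pos neg S δ δ' := by
  have hsmall := isSmallPair_of_isSegrePairingOf hg hg0 hann hS
  obtain ⟨N, p, rfl⟩ := exists_fin_map_eq S
  have hp : ∀ i, IsSmallPair (p i) := by simpa using hsmall
  obtain ⟨s, ⟨r, k, ev, hk, hsim, rfl⟩, hs, -⟩ := hS
  obtain ⟨hpos, hneg, hev⟩ := hen
  obtain ⟨d, ν, hν⟩ := exists_fin_map_eq
    (Finset.univ.val.map (fun j => ((δ j : ℤ) : ℂ) * (Real.sqrt (pos j) : ℂ)) +
      Finset.univ.val.map fun j => Complex.I * ((δ' j : ℤ) : ℂ) * (Real.sqrt (-neg j) : ℂ))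
  have hsq : (Finset.univ.val.map fun i => ν i * ν i) =
      Finset.univ.val.map (fun j => (pos j : ℂ)) + Finset.univ.val.map fun j => (neg j : ℂ) := by
    have h := congrArg (Multiset.map fun z => z * z) hν
    rw [Multiset.map_add, Multiset.map_map, Multiset.map_map, Multiset.map_map] at h
    refine h.trans ?_
    congr 1
    · exact Multiset.map_congr rfl fun j _ => signed_sqrt_sq (hpos j).le (δ j)
    · exact Multiset.map_congr rfl fun j _ => signed_sqrt_neg_sq (hneg j).le (δ' j)
  have hν0 : ∀ i, ν i ≠ 0 := fun i h0 => by
    have h : ν i * ν i ∈ Finset.univ.val.map fun i => ν i * ν i :=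
      Multiset.mem_map_of_mem (fun i => ν i * ν i) (Finset.mem_univ i)
    rw [hsq, ← hev, h0, mul_zero] at h
    exact (Multiset.mem_filter.1 h).2 rfl
  have hdata := eq_diagonal_add_nilpotent_data (M := jordanData k ev)
    (fun z hz => (mem_jordanData hz).1) fun z hz hz0 => by
      obtain ⟨-, i, hi, hi'⟩ := mem_jordanData hz
      exact hi ▸ (sizes_of_annihilator hg hg0 hann hsim i).1 (hi' ▸ hz0)
  have hroots := roots_charpoly_of_jordanData hsim (fun z hz => by
    obtain ⟨x, hx, rfl⟩ := Multiset.mem_map.1 hz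
    exact (Multiset.mem_filter.1 hx).2) hdata
  have hzero : ((jordanData k ev).filter fun z => z.2 = 0).map Prod.fst =
      (Finset.univ.filter fun i => ev i = 0).val.map k := by
    have hself : jordanData k ev = Finset.univ.val.map fun i => (k i, ev i) := by
      rw [jordanData, Multiset.filter_eq_self]
      simpa using fun i => (hk i).ne'
    rw [hself, Multiset.filter_map, Multiset.map_map]
    rfl
  -- The nonzero part of the data of `B` is now the squares of `ν` and the zero part the members of
  -- the pairs, which is precisely the data of the square of the model `A₀`.
  rw [hzero, ← hroots, hev, ← hsq, ← hs, ← sq_jordanData hp] at hdata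
  let A₀ := dsum (diagonal ν) (jordanSum (fun i => (p i).1 + (p i).2) fun _ => 0)
  obtain ⟨P, Q, hPQ, hQ⟩ := (sq_similar_jordanSum hp (Similar.refl A₀)).trans
    ((similar_of_jordanData_eq hdata.symm).trans hsim.symm)
  have hA : (Q * A₀ * P) * (Q * A₀ * P) = B := by rw [← MutuallyInverse.conj_mul hPQ, hQ]
  have hAs : Similar (Q * A₀ * P) A₀ := Similar.symm ⟨P, Q, hPQ, rfl⟩
  exact ⟨Q * A₀ * P, by rw [pow_two, hA], isAssociatedWith_of_similar hA hν0 hp hAs,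
    hasRootJordanForm_of_similar hp hν hAs⟩

end RootForm

end HRoot

theorem mainTheorem9 {n : ℕ} (H B : Matrix (Fin n) (Fin n) ℂ)
    (hH : H.IsHermitian) (hHinv : IsUnit H) (hB : HRoot.IsHNonnegative H B) :
    ∃ (q m : ℕ) (pos : Fin q → ℝ) (neg : Fin m → ℝ),
      HRoot.EnumeratesNonzeroEigenvalues B pos neg ∧
      (∀ A : Matrix (Fin n) (Fin n) ℂ, A ^ 2 = B →
        ∃! S : Multiset (ℕ × ℕ), HRoot.IsSegrePairingOf B S ∧ HRoot.IsAssociatedWith A B S) ∧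
      (∀ (A : Matrix (Fin n) (Fin n) ℂ) (S : Multiset (ℕ × ℕ)), A ^ 2 = B →
        HRoot.IsSegrePairingOf B S → HRoot.IsAssociatedWith A B S →
          ∃ (δ : Fin q → ℤˣ) (δ' : Fin m → ℤˣ), HRoot.HasRootJordanForm A pos neg S δ δ') ∧
      (∀ (S : Multiset (ℕ × ℕ)) (δ : Fin q → ℤˣ) (δ' : Fin m → ℤˣ), HRoot.IsSegrePairingOf B S →
        ∃ A : Matrix (Fin n) (Fin n) ℂ, A ^ 2 = B ∧ HRoot.IsAssociatedWith A B S ∧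
          HRoot.HasRootJordanForm A pos neg S δ δ') := by
  obtain ⟨g, hg, hg0, hreal, hann⟩ := HRoot.exists_annihilator hH hHinv hB
  obtain ⟨q, m, pos, neg, hen⟩ := HRoot.exists_enumeration hreal hann
  refine ⟨q, m, pos, neg, hen, fun A hA => ?_, fun A S hA hS h => ?_, fun S δ δ' hS => ?_⟩
  · rw [pow_two] at hA
    obtain ⟨S, hS, hAS⟩ := HRoot.exists_isAssociatedWith hA hg hg0 hann
    refine ⟨S, ⟨hS, hAS⟩, fun S' hS' => ?_⟩
    exact hS'.2.unique hAS (HRoot.isSmallPair_of_isSegrePairingOf hg hg0 hann hS'.1)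
      (HRoot.isSmallPair_of_isSegrePairingOf hg hg0 hann hS)
  · rw [pow_two] at hA
    exact h.hasRootJordanForm hA hg hg0 hann hen hS
  · exact HRoot.exists_root hg hg0 hann hen hS δ δ'
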